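/- Let $P$ be a II$_1$ factor, let $H$ and $K$ be finite groups with properly outer actions $\sigma$, resp. $\rho$, on $P$ (that is, $\sigma_h$ and $\rho_k$ are not inner for $h\neq 1$, $k\neq 1$), and put $N=P^H$ and $M=P\rtimes K$. Let $P_{-1}\subset N\subset P\subset M\subset P_1$, with $P_{-1}$ a II$_1$ factor, be such that $N\subset P$ is the basic construction for $P_{-1}\subset N$ and $M\subset P_1$ is the basic construction for $P\subset M$. Then $P_{-1}\subset P_1$ is a locally trivial inclusion given by the automorphisms $\{\rho_k\sigma_h\}_{h\in H,\,k\in K}$, in the following sense. There are matrix units $\{f_{h,h'}\}_{h,h'\in H}$ in $P$, with $\sum_h f_{h,h}=1$, spanning a matrix factor $B\cong B(\ell^2(H))$, and unitaries $u_h, v_k\in P$ with $u_1=v_1=1$, such that the perturbed automorphisms $\sigma'_h=\mathrm{Ad}(u_h)\circ\sigma_h$ and $\rho'_k=\mathrm{Ad}(v_k)\circ\rho_k$ fix every $f_{h,h'}$, and hence restrict to automorphisms of $Q=B'\cap P$; and the inclusion $P_{-1}\subset P_1$ is isomorphic to the inclusion $$Q\hookrightarrow Q\otimes B(\ell^2(H))\otimes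 B(\ell^2(K)),\qquad x\mapsto\sum_{h\in H,\,k\in K}\rho'_k\sigma'_h(x)\,f_{h,h}\,e_{k,k},$$ where $f_{h,h'}$ and $e_{k,k'}$ also denote the matrix units of $B(\ell^2(H))$ and $B(\ell^2(K))$ (so $Q\cong P_{-1}$). That is, there are $*$-isomorphisms $\varphi:P_{-1}\to Q$ and $\Phi:P_1\to Q\otimes B(\ell^2(H))\otimes B(\ell^2(K))$ with $\Phi(y)=\sum_{h,k}\rho'_k\sigma'_h(\varphi(y))\,f_{h,h}\,e_{k,k}$ for all $y\in P_{-1}$. -/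

import Mathlib

open scoped ComplexOrder

universe u v w

noncomputable section

namespace Subfactor

section Tracial

variable {A : Type u} [Ring A] [StarRing A] [Algebra ℂ A] [StarModule ℂ A]

/-- A faithful tracial state on a `*`-algebra. -/
structure IsFaithfulTrace (τ : A →ₗ[ℂ] ℂ) : Prop where
  map_one : τ 1 = 1
  nonneg : ∀ a, 0 ≤ τ (star a * a)
  faithful : ∀ a, τ (star a * a) = 0 → a = 0
  tracial : ∀ a b, τ (a * b) = τ (b * a)

/-- `π` is the GNS representation of `A` on the Hilbert space `L = L²(A, τ)`, and `Ω` is the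
vector given by the unit of `A`: the vectors `â = π(a)Ω` are dense and `⟨Ω, π(a)Ω⟩ = τ(a)`, so
that `⟨â, b̂⟩ = τ(a⋆b)` and `π(a)b̂` is the vector of `ab`. The triple `(L, π, Ω)` is determined
by `τ` up to a unique unitary. -/
structure IsGNS {L : Type v} [NormedAddCommGroup L] [InnerProductSpace ℂ L] [CompleteSpace L]
    (τ : A →ₗ[ℂ] ℂ) (π : A →⋆ₐ[ℂ] (L →L[ℂ] L)) (Ω : L) : Prop where
  cyclic : Dense (Set.range fun a : A => π a Ω)
  vector_state : ∀ a, inner ℂ Ω (π a Ω) = τ a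

/-- `A` is a II₁ factor with trace `τ`: `τ` is a faithful tracial state, `A` acts on `L²(A, τ)` as
a von Neumann algebra (which makes `τ` normal, being a vector state), the centre is trivial, and
`A` is infinite-dimensional. The trace of a II₁ factor is unique, so `τ` is no extra structure. -/
structure IsIIOneFactor (τ : A →ₗ[ℂ] ℂ) : Prop where
  trace : IsFaithfulTrace τ
  vonNeumann : ∃ (L : Type u) (_ : NormedAddCommGroup L) (_ : InnerProductSpace ℂ L)
    (_ : CompleteSpace L) (π : A →⋆ₐ[ℂ] (L →L[ℂ] L)) (Ω : L) (S : VonNeumannAlgebra L),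
    IsGNS τ π Ω ∧ Set.range π = (S : Set (L →L[ℂ] L))
  center_trivial : Subalgebra.center ℂ A = ⊥
  infinite_dimensional : ¬ FiniteDimensional ℂ A

/-- The restriction of a functional to a subalgebra. -/
def restrictTrace (τ : A →ₗ[ℂ] ℂ) (B : StarSubalgebra ℂ A) : B →ₗ[ℂ] ℂ :=
  τ ∘ₗ B.subtype.toAlgHom.toLinearMap

end Tracial

section BasicConstruction

variable {L : Type u} [NormedAddCommGroup L] [InnerProductSpace ℂ L] [CompleteSpace L]

/-- The von Neumann algebra generated by a set `X` of bounded operators: the double commutant of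
`X ∪ X⋆`. -/
def generatedVonNeumann (X : Set (L →L[ℂ] L)) : VonNeumannAlgebra L where
  toStarSubalgebra := StarSubalgebra.centralizer ℂ (StarSubalgebra.centralizer ℂ X)
  centralizer_centralizer' := by
    show Set.centralizer (Set.centralizer
      ((StarSubalgebra.centralizer ℂ
        ((StarSubalgebra.centralizer ℂ X : StarSubalgebra ℂ (L →L[ℂ] L)) : Set (L →L[ℂ] L)) :
        StarSubalgebra ℂ (L →L[ℂ] L)) : Set (L →L[ℂ] L))) =
      ((StarSubalgebra.centralizer ℂ
        ((StarSubalgebra.centralizer ℂ X : StarSubalgebra ℂ (L →L[ℂ] L)) : Set (L →L[ℂ] L)) :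
        StarSubalgebra ℂ (L →L[ℂ] L)) : Set (L →L[ℂ] L))
    rw [StarSubalgebra.coe_centralizer, Set.centralizer_centralizer_centralizer]

variable {A : Type u} [Ring A] [StarRing A] [Algebra ℂ A] [StarModule ℂ A]

/-- The closed subspace `L²(B)` of `L²(A)`, the closure of `{b̂ | b ∈ B}`. -/
def subspaceOf (π : A →⋆ₐ[ℂ] (L →L[ℂ] L)) (Ω : L) (B : StarSubalgebra ℂ A) : Submodule ℂ L :=
  (Submodule.span ℂ ((fun b : A => π b Ω) '' (B : Set A))).topologicalClosure

instance (π : A →⋆ₐ[ℂ] (L →L[ℂ] L)) (Ω : L) (B : StarSubalgebra ℂ A) :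
    CompleteSpace (subspaceOf π Ω B) :=
  Submodule.topologicalClosure.completeSpace _

/-- The Jones projection `e_B`: the orthogonal projection of `L²(A)` onto `L²(B)`. -/
def jonesProjection (π : A →⋆ₐ[ℂ] (L →L[ℂ] L)) (Ω : L) (B : StarSubalgebra ℂ A) : L →L[ℂ] L :=
  (subspaceOf π Ω B).starProjection

/-- The algebra `⟨A, e_B⟩` on `L²(A)`, generated by `A` and the Jones projection. -/
def jonesAlgebra (π : A →⋆ₐ[ℂ] (L →L[ℂ] L)) (Ω : L) (B : StarSubalgebra ℂ A) :
    VonNeumannAlgebra L :=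
  generatedVonNeumann (Set.range π ∪ {jonesProjection π Ω B})

/-- `A → C` is the basic construction for `B ⊆ A`: there is an isomorphism of `C` with the algebra
`⟨A, e_B⟩` on `L²(A, τ)` that carries `A → C` to the action of `A` on `L²(A, τ)`. -/
def IsBasicConstruction {C : Type v} [Ring C] [StarRing C] [Algebra ℂ C]
    (τ : A →ₗ[ℂ] ℂ) (B : StarSubalgebra ℂ A) (ι : A →⋆ₐ[ℂ] C) : Prop :=
  ∃ (L : Type u) (_ : NormedAddCommGroup L) (_ : InnerProductSpace ℂ L) (_ : CompleteSpace L)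
    (π : A →⋆ₐ[ℂ] (L →L[ℂ] L)) (Ω : L), IsGNS τ π Ω ∧
    ∃ Φ : C ≃⋆ₐ[ℂ] (jonesAlgebra π Ω B).toStarSubalgebra, ∀ a : A, (Φ (ι a) : L →L[ℂ] L) = π a

end BasicConstruction

section Actions

variable {P : Type u} [Ring P] [StarRing P] [Algebra ℂ P] [StarModule ℂ P]

/-- An action on a factor is properly outer if no nontrivial group element acts by an inner
automorphism `Ad u`, `u` unitary. -/
def IsProperlyOuter {G : Type v} [Group G] (σ : G →* (P ≃⋆ₐ[ℂ] P)) : Prop :=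
  ∀ g : G, g ≠ 1 → ∀ u : unitary P, σ g ≠ Unitary.conjStarAlgAut ℂ P u

/-- The fixed point algebra `P^G`. -/
def fixedAlgebra {G : Type v} [Group G] (σ : G →* (P ≃⋆ₐ[ℂ] P)) : StarSubalgebra ℂ P where
  carrier := {x | ∀ g, σ g x = x}
  mul_mem' hx hy g := by rw [map_mul, hx g, hy g]
  one_mem' g := map_one _
  add_mem' hx hy g := by rw [map_add, hx g, hy g]
  zero_mem' g := map_zero _
  algebraMap_mem' c g := by
    rw [Algebra.algebraMap_eq_smul_one, map_smul, map_one]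
  star_mem' hx g := by rw [map_star, hx g]

variable {K : Type v} [Group K] [Fintype K] [DecidableEq K]

/-- The action of `P` on `L²(P) ⊗ ℓ²(K)` that enters the crossed product, written as matrices over
`P`: the diagonal matrix with entries `ρ_k⁻¹(x)`. -/
def crossedDiag (ρ : K →* (P ≃⋆ₐ[ℂ] P)) : P →⋆ₐ[ℂ] Matrix K K P where
  toFun x := Matrix.diagonal fun k => ρ k⁻¹ x
  map_one' := by simp
  map_mul' x y := by simp
  map_zero' := by simp
  map_add' x y := by simp
  commutes' c := by
    ext i j
    by_cases h : i = j <;> simp [h, Matrix.algebraMap_matrix_apply, Algebra.algebraMap_eq_smul_one]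
  map_star' x := by
    simp [Matrix.star_eq_conjTranspose, Matrix.diagonal_conjTranspose, Pi.star_def, map_star]

/-- The unitary `1 ⊗ λ_g` given by left translation by `g` on `ℓ²(K)`. -/
def crossedUnitary (P : Type u) [Ring P] (g : K) : Matrix K K P :=
  Matrix.of fun k l => if k = g * l then 1 else 0

/-- The crossed product `P ⋊ K` by a finite group, as the algebra generated by `P` and the
unitaries `λ_g`, `λ_g x λ_g⋆ = ρ_g(x)`. As `K` is finite, its elements are the finite sums
`∑ x_g λ_g`, so the generated `*`-algebra is already weakly closed. -/
def crossedProduct (ρ : K →* (P ≃⋆ₐ[ℂ] P)) : StarSubalgebra ℂ (Matrix K K P) :=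
  StarAlgebra.adjoin ℂ (Set.range (crossedDiag ρ) ∪ Set.range (crossedUnitary P))

/-- The inclusion `P ⊆ P ⋊ K`. -/
def crossedInclusion (ρ : K →* (P ≃⋆ₐ[ℂ] P)) : P →⋆ₐ[ℂ] crossedProduct ρ :=
  StarAlgHom.codRestrict (crossedDiag ρ) (crossedProduct ρ) fun x =>
    StarAlgebra.subset_adjoin ℂ _ (Or.inl ⟨x, rfl⟩)

/-- The trace `∑ x_g λ_g ↦ τ(x_1)` of `P ⋊ K`; `x_1` is the entry at `(1, 1)`. -/
def crossedTrace (τ : P →ₗ[ℂ] ℂ) (ρ : K →* (P ≃⋆ₐ[ℂ] P)) : crossedProduct ρ →ₗ[ℂ] ℂ where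
  toFun a := τ ((a : Matrix K K P) 1 1)
  map_add' a b := by simp
  map_smul' c a := by simp

end Actions

section LocallyTrivial

variable {ι : Type w}

/-- The inclusion `x ↦ ∑ᵢ θᵢ(x) eᵢᵢ` of `Q` in `Q ⊗ Mₙ(ℂ)`, given by automorphisms `θᵢ` of `Q`. -/
def locallyTrivial [Fintype ι] [DecidableEq ι] {Q : Type u} [Ring Q] [StarRing Q] [Algebra ℂ Q]
    (θ : ι → (Q ≃⋆ₐ[ℂ] Q)) : Q →⋆ₐ[ℂ] Matrix ι ι Q where
  toFun x := Matrix.diagonal fun i => θ i x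
  map_one' := by simp
  map_mul' x y := by simp
  map_zero' := by simp
  map_add' x y := by simp
  commutes' c := by
    ext i j
    by_cases h : i = j <;> simp [h, Matrix.algebraMap_matrix_apply, Algebra.algebraMap_eq_smul_one]
  map_star' x := by
    simp [Matrix.star_eq_conjTranspose, Matrix.diagonal_conjTranspose, Pi.star_def, map_star]

/-- Isomorphism of inclusions `A → B` and `A' → B'`: an isomorphism of `B` with `B'` that carries
the image of `A` to the image of `A'`. -/
def InclusionIso {A : Type*} {B : Type*} {A' : Type*} {B' : Type*}
    [Ring A] [StarRing A] [Algebra ℂ A] [Ring B] [StarRing B] [Algebra ℂ B]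
    [Ring A'] [StarRing A'] [Algebra ℂ A'] [Ring B'] [StarRing B'] [Algebra ℂ B']
    (i : A →⋆ₐ[ℂ] B) (j : A' →⋆ₐ[ℂ] B') : Prop :=
  ∃ (φ : A ≃⋆ₐ[ℂ] A') (Φ : B ≃⋆ₐ[ℂ] B'), ∀ a, Φ (i a) = j (φ a)

variable {P : Type u} [Ring P] [StarRing P] [Algebra ℂ P] [StarModule ℂ P]

/-- A system of matrix units in `P` (spanning a unital matrix subfactor `B ≅ B(ℓ²(ι))`). -/
structure IsMatrixUnits [Fintype ι] [DecidableEq ι] (f : ι → ι → P) : Prop where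
  mul : ∀ a b c d, f a b * f c d = if b = c then f a d else 0
  star : ∀ a b, star (f a b) = f b a
  sum : ∑ a, f a a = 1

/-- The relative commutant `B' ∩ P` of the algebra `B` spanned by the `f a b`. -/
def relCommutant (f : ι → ι → P) : StarSubalgebra ℂ P :=
  StarSubalgebra.centralizer ℂ (Set.range fun p : ι × ι => f p.1 p.2)

theorem map_mem_relCommutant {f : ι → ι → P} (α : P ≃⋆ₐ[ℂ] P) (hα : ∀ a b, α (f a b) = f a b)
    {x : P} (hx : x ∈ relCommutant f) : α x ∈ relCommutant f := by
  rw [relCommutant, StarSubalgebra.mem_centralizer_iff] at hx ⊢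
  rintro _ ⟨p, rfl⟩
  have h := hx _ ⟨p, rfl⟩
  refine ⟨?_, ?_⟩
  · have h1 := congrArg α h.1
    rwa [map_mul, map_mul, hα] at h1
  · have h2 := congrArg α h.2
    rwa [map_mul, map_mul, map_star, hα] at h2

/-- The restriction to `B' ∩ P` of an automorphism of `P` that fixes the matrix units of `B`. -/
def restrictAut {f : ι → ι → P} (α : P ≃⋆ₐ[ℂ] P) (hα : ∀ a b, α (f a b) = f a b) :
    relCommutant f ≃⋆ₐ[ℂ] relCommutant f where
  toFun x := ⟨α x, map_mem_relCommutant α hα x.2⟩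
  invFun x := ⟨α.symm x, map_mem_relCommutant α.symm
    (fun a b => by rw [StarAlgEquiv.symm_apply_eq, hα]) x.2⟩
  left_inv x := by simp
  right_inv x := by simp
  map_mul' x y := by ext; simp
  map_add' x y := by ext; simp
  map_star' x := by ext; simp [map_star]
  map_smul' c x := by ext; simp

end LocallyTrivial

end Subfactor

end

/-!
The proof avoids index theory and the uniqueness of the trace. It rests on three facts.

*Comparison.* Two projections `p`, `q` of a factor `S` are comparable
(`exists_comparison_of_factor`): an extreme point `x` of the weakly compact unit ball of `q S p` is
a partial isometry with `(q - x x⋆) S (p - x⋆ x) = 0`. In a II₁ factor it follows, with a trace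
averaged over the group, that a projection is equivalent to its images under a finite group of
automorphisms (`IsIIOneFactor.exists_equivalence`), and that `1 = ∑ aᵢ e bᵢ` for every projection
`e ≠ 0` (`IsIIOneFactor.exists_sum_eq_one`).

*Compression.* By the commutation theorem for a trace, `e T e ∈ B e` for `T` in the basic
construction `⟨A, e⟩` of `B ⊆ A` (`IsGNS.exists_compression_eq`).

*Outerness.* Let `e ∈ P` be the Jones projection of `P₋₁ ⊆ N`. As `e P e = P₋₁ e` and `P₋₁` is
pointwise fixed by `σ_h`, the element `∑ aᵢ e σ_h(e) σ_h(bᵢ)` intertwines the identity and `σ_h`,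
so it vanishes for `h ≠ 1`, and `e σ_h(e) = 0` (`IsIIOneFactor.mul_map_eq_zero`). The projection
`∑ σ_h(e)` of `N` dominates `e`, hence is `1`, because the cyclic vector separates `N`.

The projections `σ_h(e)` are therefore the diagonal of matrix units `f` of `P`
(`IsIIOneFactor.exists_matrixUnits`), with `B' ∩ P` isomorphic to the corner `e P e = P₋₁ e`. The
unitary `u_h` is built from the partial isometry `f_{1,h}` that carries `σ_h(e)` to `e`, and `v_k`
from an equivalence of `ρ_k(e)` with `e`. The Jones projection `E` of `P ⊆ P ⋊ K` has the corner `P`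
and orthogonal translates `λ_k⋆ E λ_k` with sum `1` (`exists_crossed_projection`). Thus `P₁` has
matrix units indexed by `H × K` with corner `B' ∩ P`, and in these `y ∈ P₋₁` is diagonal with entries
`ρ'_k σ'_h(φ(y))` (`IsIIOneFactor.exists_locallyTrivial`).
-/

noncomputable section

namespace Subfactor

/-! ### Comparison of projections in a factor -/

section Comparison

variable {L : Type*} [NormedAddCommGroup L] [InnerProductSpace ℂ L]

/-- The sesquilinear form `(ξ, η) ↦ ⟨ξ, Tη⟩` of an operator, as a function on `L × L`. -/
def matrixCoeff : (L →L[ℂ] L) →ₗ[ℝ] (L × L → ℂ) where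
  toFun T z := inner ℂ z.1 (T z.2)
  map_add' S T := by ext z; simp
  map_smul' c T := by
    ext z
    rw [← Complex.coe_smul]
    simp

theorem matrixCoeff_apply (T : L →L[ℂ] L) (z : L × L) :
    matrixCoeff T z = inner ℂ z.1 (T z.2) := rfl

theorem matrixCoeff_injective :
    Function.Injective (matrixCoeff : (L →L[ℂ] L) →ₗ[ℝ] (L × L → ℂ)) := by
  intro S T h
  ext ξ
  refine ext_inner_left ℂ fun η => ?_
  exact congrFun h (η, ξ)

/-- The functions on `L × L` that are sesquilinear forms of norm at most `1`. -/
def contractiveForms (L : Type*) [NormedAddCommGroup L] [InnerProductSpace ℂ L] :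
    Set (L × L → ℂ) :=
  {f | (∀ z, ‖f z‖ ≤ ‖z.1‖ * ‖z.2‖) ∧
    (∀ ξ ξ' η, f (ξ + ξ', η) = f (ξ, η) + f (ξ', η)) ∧
    (∀ (c : ℂ) ξ η, f (c • ξ, η) = star c * f (ξ, η)) ∧
    (∀ ξ η η', f (ξ, η + η') = f (ξ, η) + f (ξ, η')) ∧
    (∀ (c : ℂ) ξ η, f (ξ, c • η) = c * f (ξ, η))}

theorem exists_matrixCoeff_eq [CompleteSpace L] {f : L × L → ℂ} (hf : f ∈ contractiveForms L) :
    ∃ T : L →L[ℂ] L, ‖T‖ ≤ 1 ∧ matrixCoeff T = f := by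
  obtain ⟨hb, h1, h2, h3, h4⟩ := hf
  let B : L →L⋆[ℂ] L →L[ℂ] ℂ := LinearMap.mkContinuous₂
    (LinearMap.mk₂'ₛₗ (starRingEnd ℂ) (RingHom.id ℂ) (fun ξ η => f (ξ, η)) h1
      (fun c ξ η => by simpa using h2 c ξ η) h3 (fun c ξ η => by simpa using h4 c ξ η)) 1
    (fun ξ η => by simpa using hb (ξ, η))
  have hB : ∀ ξ η, B ξ η = f (ξ, η) := fun ξ η => rfl
  let T : L →L[ℂ] L := InnerProductSpace.continuousLinearMapOfBilin B
  have hT : ∀ ξ η, inner ℂ (T ξ) η = f (ξ, η) := fun ξ η => by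
    rw [← hB]; exact InnerProductSpace.continuousLinearMapOfBilin_apply B ξ η
  have hco : matrixCoeff (ContinuousLinearMap.adjoint T) = f := by
    ext ⟨ξ, η⟩
    rw [matrixCoeff_apply, ContinuousLinearMap.adjoint_inner_right, hT]
  refine ⟨ContinuousLinearMap.adjoint T, ?_, hco⟩
  rw [LinearIsometryEquiv.norm_map]
  refine ContinuousLinearMap.opNorm_le_of_re_inner_le zero_le_one fun ξ η hξ hη => ?_
  rw [hT]
  simpa [hξ, hη] using (Complex.re_le_norm _).trans (hb (ξ, η))

theorem matrixCoeff_mem_contractiveForms {T : L →L[ℂ] L} (hT : ‖T‖ ≤ 1) :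
    matrixCoeff T ∈ contractiveForms L := by
  refine ⟨fun z => ?_, ?_, ?_, ?_, ?_⟩
  · refine (norm_inner_le_norm _ _).trans ?_
    gcongr
    simpa using T.le_of_opNorm_le hT z.2
  · simp [matrixCoeff_apply]
  · simp [matrixCoeff_apply, mul_comm]
  · simp [matrixCoeff_apply]
  · simp [matrixCoeff_apply]

theorem isCompact_contractiveForms : IsCompact (contractiveForms L) := by
  refine IsCompact.of_isClosed_subset
    (isCompact_univ_pi fun z : L × L => isCompact_closedBall (0 : ℂ) (‖z.1‖ * ‖z.2‖)) ?_
    (fun f hf z _ => by simpa using hf.1 z)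
  simp only [contractiveForms, Set.ofPred_and, Set.ofPred_forall]
  refine IsClosed.inter ?_ (IsClosed.inter ?_ (IsClosed.inter ?_ (IsClosed.inter ?_ ?_)))
  · exact isClosed_iInter fun z => isClosed_le (by fun_prop) (by fun_prop)
  all_goals
    refine isClosed_iInter fun _ => isClosed_iInter fun _ => isClosed_iInter fun _ =>
      isClosed_eq (by fun_prop) (by fun_prop)

variable [CompleteSpace L]

/-- The forms of the contractions in the corner `q S p` of a von Neumann algebra. -/
theorem isCompact_corner (S : VonNeumannAlgebra L) {p q : L →L[ℂ] L} (hq : star q = q) :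
    IsCompact (matrixCoeff '' {x : L →L[ℂ] L | ‖x‖ ≤ 1 ∧ x ∈ S ∧ q * x * p = x}) := by
  have heq : matrixCoeff '' {x : L →L[ℂ] L | ‖x‖ ≤ 1 ∧ x ∈ S ∧ q * x * p = x} =
      contractiveForms L ∩ ({f | ∀ c ∈ S.commutant, ∀ ξ η, f (star c ξ, η) = f (ξ, c η)} ∩
        {f | ∀ ξ η, f (q ξ, p η) = f (ξ, η)}) := by
    ext f
    constructor
    · rintro ⟨x, ⟨hx, hxS, hqp⟩, rfl⟩
      refine ⟨matrixCoeff_mem_contractiveForms hx, fun c hc ξ η => ?_, fun ξ η => ?_⟩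
      · rw [VonNeumannAlgebra.mem_commutant_iff] at hc
        have := DFunLike.congr_fun (hc x hxS) η
        simp only [matrixCoeff_apply, ContinuousLinearMap.star_eq_adjoint,
          ContinuousLinearMap.adjoint_inner_left]
        exact congrArg (inner ℂ ξ) this.symm
      · conv_rhs => rw [matrixCoeff_apply, ← hqp]
        simp only [matrixCoeff_apply, mul_apply_eq_comp]
        conv_lhs => rw [← hq]
        rw [ContinuousLinearMap.star_eq_adjoint, ContinuousLinearMap.adjoint_inner_left]
    · rintro ⟨hf, hc, hpq⟩
      obtain ⟨T, hT, rfl⟩ := exists_matrixCoeff_eq hf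
      refine ⟨T, ⟨hT, ?_, ?_⟩, rfl⟩
      · rw [← VonNeumannAlgebra.commutant_commutant S, VonNeumannAlgebra.mem_commutant_iff]
        intro c hcS
        ext η
        refine ext_inner_left ℂ fun ξ => ?_
        have := hc c hcS ξ η
        simp only [matrixCoeff_apply, ContinuousLinearMap.star_eq_adjoint,
          ContinuousLinearMap.adjoint_inner_left] at this
        exact this
      · ext η
        refine ext_inner_left ℂ fun ξ => ?_
        have := hpq ξ η
        simp only [matrixCoeff_apply] at this
        rw [← this]
        simp only [mul_apply_eq_comp]
        conv_rhs => rw [← hq]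
        rw [ContinuousLinearMap.star_eq_adjoint, ContinuousLinearMap.adjoint_inner_left]
  rw [heq]
  refine isCompact_contractiveForms.inter_right (IsClosed.inter ?_ ?_)
  · simp only [Set.ofPred_forall]
    exact isClosed_iInter fun c => isClosed_iInter fun _ => isClosed_iInter fun _ =>
      isClosed_iInter fun _ => isClosed_eq (by fun_prop) (by fun_prop)
  · simp only [Set.ofPred_forall]
    exact isClosed_iInter fun _ => isClosed_iInter fun _ => isClosed_eq (by fun_prop) (by fun_prop)

/-- Krein–Milman for the unit ball of `q S p`, in the form in which it is used: `x` is its own only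
perturbation in both directions `±d`. -/
theorem exists_extreme_corner (S : VonNeumannAlgebra L) {p q : L →L[ℂ] L} (hq : star q = q) :
    ∃ x ∈ S, ‖x‖ ≤ 1 ∧ q * x * p = x ∧
      ∀ d ∈ S, q * d * p = d → ‖x + d‖ ≤ 1 → ‖x - d‖ ≤ 1 → d = 0 := by
  obtain ⟨f, ⟨x, ⟨hx1, hxS, hxc⟩, rfl⟩, hext⟩ :=
    (isCompact_corner S (p := p) hq).extremePoints_nonempty ⟨_, 0, by simp [zero_mem], rfl⟩
  refine ⟨x, hxS, hx1, hxc, fun d hd hdc hp hm => ?_⟩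
  have h := hext (x₁ := matrixCoeff (x + d)) (x₂ := matrixCoeff (x - d))
    ⟨x + d, ⟨hp, add_mem hxS hd, by rw [mul_add, add_mul, hxc, hdc]⟩, rfl⟩
    ⟨x - d, ⟨hm, sub_mem hxS hd, by rw [mul_sub, sub_mul, hxc, hdc]⟩, rfl⟩
    ⟨1 / 2, 1 / 2, by norm_num, by norm_num, by norm_num, by
      rw [← map_smul, ← map_smul, ← map_add]; congr 1; module⟩
  have := matrixCoeff_injective h
  simpa using this

/-- The projection onto a subspace that is invariant under `T` and `T⋆` commutes with `T`. -/
theorem starProjection_commute_of_invariant (V : Submodule ℂ L) [CompleteSpace V] {T : L →L[ℂ] L}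
    (h : ∀ ξ ∈ V, T ξ ∈ V) (h' : ∀ ξ ∈ V, (star T) ξ ∈ V) :
    T * V.starProjection = V.starProjection * T := by
  have h1 : ∀ T : L →L[ℂ] L, (∀ ξ ∈ V, T ξ ∈ V) →
      V.starProjection * (T * V.starProjection) = T * V.starProjection := by
    intro T hT
    ext ξ
    exact Submodule.starProjection_eq_self_iff.2 (hT _ (by simp))
  have hs : star V.starProjection = V.starProjection := isSelfAdjoint_starProjection V
  have h2 := congrArg star (h1 _ h')
  simp only [star_mul, star_star, hs] at h2
  rw [← h1 T h, ← mul_assoc, h2]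

/-- In a factor, `q S p = 0` forces `p = 0` or `q = 0`: the projection onto the closed span of
`S p L` lies in the centre. -/
theorem eq_zero_or_eq_zero_of_corner (S : VonNeumannAlgebra L)
    (hS : ∀ z ∈ S, z ∈ S.commutant → ∃ c : ℂ, z = c • 1) {p q : L →L[ℂ] L} (hp : p ∈ S)
    (h : ∀ y ∈ S, q * y * p = 0) : q = 0 ∨ p = 0 := by
  let V : Submodule ℂ L :=
    (Submodule.span ℂ {ξ | ∃ y ∈ S, ∃ η, ξ = y (p η)}).topologicalClosure
  have : CompleteSpace V := Submodule.topologicalClosure.completeSpace _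
  have key : ∀ T : L →L[ℂ] L, (∀ y ∈ S, ∀ η, T (y (p η)) ∈ V) → ∀ ξ ∈ V, T ξ ∈ V := by
    intro T hT ξ hξ
    have hle : Submodule.span ℂ {ξ | ∃ y ∈ S, ∃ η, ξ = y (p η)} ≤ V.comap (T : L →ₗ[ℂ] L) := by
      rw [Submodule.span_le]
      rintro _ ⟨y, hy, η, rfl⟩
      exact hT y hy η
    have hcl : IsClosed ((V.comap (T : L →ₗ[ℂ] L) : Submodule ℂ L) : Set L) :=
      (Submodule.isClosed_topologicalClosure _).preimage T.continuous
    exact Submodule.topologicalClosure_minimal _ hle hcl hξ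
  have hgen : ∀ y ∈ S, ∀ η, y (p η) ∈ V := fun y hy η =>
    Submodule.le_topologicalClosure _ (Submodule.subset_span ⟨y, hy, η, rfl⟩)
  have hproj : ∀ D : VonNeumannAlgebra L, (∀ T ∈ D, ∀ ξ ∈ V, T ξ ∈ V) →
      V.starProjection ∈ D.commutant := by
    intro D hD
    rw [VonNeumannAlgebra.mem_commutant_iff]
    intro T hT
    exact starProjection_commute_of_invariant V (hD T hT) (hD _ (star_mem hT))
  have hz1 : V.starProjection ∈ S.commutant := hproj S fun T hT => key T fun y hy η => by
    have := hgen (T * y) (mul_mem hT hy) η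
    simpa using this
  have hz2 : V.starProjection ∈ S := by
    rw [← VonNeumannAlgebra.commutant_commutant S]
    refine hproj _ fun T hT => key T fun y hy η => ?_
    rw [VonNeumannAlgebra.mem_commutant_iff] at hT
    have e : T (y (p η)) = y (p (T η)) := by
      have h1 := DFunLike.congr_fun (hT (y * p) (mul_mem hy hp)) η
      simpa using h1.symm
    rw [e]
    exact hgen y hy _
  obtain ⟨c, hc⟩ := hS _ hz2 hz1
  have hpV : V.starProjection * p = p := by
    ext ξ
    exact Submodule.starProjection_eq_self_iff.2 (by simpa using hgen 1 (one_mem S) ξ)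
  have hqV : q * V.starProjection = 0 := by
    ext ξ
    have hle : V ≤ LinearMap.ker (q : L →ₗ[ℂ] L) := by
      refine Submodule.topologicalClosure_minimal _ ?_ (ContinuousLinearMap.isClosed_ker q)
      rw [Submodule.span_le]
      rintro _ ⟨y, hy, η, rfl⟩
      simpa using DFunLike.congr_fun (h y hy) η
    exact hle (by simp)
  by_cases hc0 : c = 0
  · right
    rw [← hpV, hc, hc0, zero_smul, zero_mul]
  · left
    rw [hc, mul_smul_comm, mul_one] at hqV
    exact (smul_eq_zero.1 hqV).resolve_left hc0

/-- A criterion for contractions: `z⋆z = 1 - (a⋆a - b⋆b)` with `b⋆b ≤ a⋆a`. -/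
theorem norm_le_one_of_star_mul_self_add {z a b : L →L[ℂ] L}
    (h : star z * z + star a * a = 1 + star b * b) (hab : ∀ ξ, ‖b ξ‖ ≤ ‖a ξ‖) : ‖z‖ ≤ 1 := by
  refine ContinuousLinearMap.opNorm_le_bound _ zero_le_one fun ξ => ?_
  have h1 := congrArg (fun T : L →L[ℂ] L => RCLike.re (inner ℂ (T ξ) ξ)) h
  simp only [add_apply, mul_apply_eq_comp, inner_add_left,
    ContinuousLinearMap.star_eq_adjoint, ContinuousLinearMap.adjoint_inner_left,
    one_apply_eq_self, map_add, inner_self_eq_norm_sq] at h1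
  rw [one_mul]
  have h2 := pow_le_pow_left₀ (norm_nonneg _) (hab ξ) 2
  exact le_of_sq_le_sq (by linarith) (norm_nonneg _)

/-- Any two projections of a factor are comparable. An extreme point `x` of the unit ball of
`q S p` is a partial isometry with `(q - x x⋆) S (p - x⋆ x) = 0`: otherwise `x` could be moved in
the directions `± x (1 - x⋆ x) / 2`, resp. `± (q - x x⋆) y (p - x⋆ x)`. -/
theorem exists_comparison_of_factor (S : VonNeumannAlgebra L)
    (hS : ∀ z ∈ S, z ∈ S.commutant → ∃ c : ℂ, z = c • 1) {p q : L →L[ℂ] L}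
    (hpS : p ∈ S) (hqS : q ∈ S) (hp : star p = p) (hpp : p * p = p) (hq : star q = q)
    (hqq : q * q = q) :
    (∃ v ∈ S, star v * v = p ∧ q * v = v) ∨ (∃ v ∈ S, star v * v = q ∧ p * v = v) := by
  obtain ⟨x, hxS, hx1, hxc, hext⟩ := exists_extreme_corner S (p := p) hq
  have hqx : q * x = x := by rw [← hxc, ← mul_assoc, ← mul_assoc, hqq]
  have hxp : x * p = x := by rw [← hxc, mul_assoc, hpp]
  have hpx : p * star x = star x := by simpa [hp] using congrArg star hxp
  have hxq : star x * q = star x := by simpa [hq] using congrArg star hqx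
  have hxS' : star x ∈ S := star_mem hxS
  set t := star x * x with ht
  have htS : t ∈ S := mul_mem hxS' hxS
  have hts : star t = t := by simp [ht]
  have hxt : x - x * t = 0 := by
    have h4 : ((1 / 2 : ℂ)) • (x - x * t) = 0 := by
      have hxtS : x - x * t ∈ S := sub_mem hxS (mul_mem hxS htS)
      refine hext _ (S.toStarSubalgebra.smul_mem hxtS _) ?_ ?_ ?_
      · have : q * (x - x * t) * p = x - x * t := by
          rw [mul_sub, sub_mul, hqx, hxp, ht, ← mul_assoc q, hqx, mul_assoc, mul_assoc, hxp]
        rw [mul_smul_comm, smul_mul_assoc, this]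
      -- `x (3 - t) / 2` is a contraction: `1 - t (3 - t)² / 4 = (1 - t)² - t (1 - t)² / 4`
      · refine norm_le_one_of_star_mul_self_add (a := 1 - t)
          (b := (1 / 2 : ℂ) • (x * (1 - t))) ?_ fun ξ => ?_
        · have e1 : star (x + (1 / 2 : ℂ) • (x - x * t)) =
              star x + (1 / 2 : ℂ) • (star x - t * star x) := by
            simp [hts]
          have e2 : star ((1 / 2 : ℂ) • (x * (1 - t))) = (1 / 2 : ℂ) • ((1 - t) * star x) := by
            simp [hts]
          rw [e1, e2, star_sub, hts, star_one]
          simp only [add_mul, mul_add, sub_mul, mul_sub, smul_mul_assoc, mul_smul_comm, smul_add,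
            smul_sub, smul_smul, one_mul, mul_one, mul_assoc, ← mul_assoc (star x) x, ← ht]
          module
        · rw [smul_apply, norm_smul, mul_apply_eq_comp]
          have := x.le_of_opNorm_le hx1 ((1 - t) ξ)
          norm_num
          norm_num at this
          linarith [norm_nonneg (ξ - t ξ)]
      · have e : x - (1 / 2 : ℂ) • (x - x * t) = (1 / 2 : ℂ) • (x * (1 + t)) := by
          rw [mul_add, mul_one]; module
        have ht1 : ‖t‖ ≤ 1 := by
          refine (norm_mul_le _ _).trans ?_
          rw [norm_star]
          exact mul_le_one₀ hx1 (norm_nonneg _) hx1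
        have h1 : ‖(1 : L →L[ℂ] L) + t‖ ≤ 2 := by
          refine (norm_add_le _ _).trans ?_
          linarith [show ‖(1 : L →L[ℂ] L)‖ ≤ 1 from ContinuousLinearMap.norm_id_le]
        rw [e, norm_smul]
        have h2 : ‖x * (1 + t)‖ ≤ 1 * 2 :=
          (norm_mul_le _ _).trans (mul_le_mul hx1 h1 (norm_nonneg _) zero_le_one)
        norm_num
        linarith
    exact (smul_eq_zero.1 h4).resolve_left (by norm_num)
  have hxt' : x * t = x := (sub_eq_zero.1 hxt).symm
  have htt : t * t = t := by
    conv_lhs => rw [ht, mul_assoc, ← ht, hxt']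
  have hpt : p * t = t := by rw [ht, ← mul_assoc, hpx]
  have htp : t * p = t := by rw [ht, mul_assoc, hxp]
  have htx : t * star x = star x := by simpa [hts] using congrArg star hxt'
  have hxx : x * star x * x = x := by rw [mul_assoc, ← ht, hxt']
  have hcorner : ∀ y ∈ S, (q - x * star x) * y * (p - t) = 0 := by
    intro y hy
    set d := (q - x * star x) * y * (p - t) with hd
    have hdS : d ∈ S :=
      mul_mem (mul_mem (sub_mem hqS (mul_mem hxS hxS')) hy) (sub_mem hpS htS)
    have hqd : q * d * p = d := by
      have h1 : q * (q - x * star x) = q - x * star x := by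
        rw [mul_sub, hqq, ← mul_assoc, hqx]
      have h2 : (p - t) * p = p - t := by rw [sub_mul, hpp, htp]
      rw [hd, mul_assoc, mul_assoc _ (p - t) p, h2, ← mul_assoc, ← mul_assoc, h1]
    have hxd : star x * d = 0 := by
      have h1 : star x * (q - x * star x) = 0 := by
        rw [mul_sub, hxq, ← mul_assoc, ← ht, htx, sub_self]
      rw [hd, mul_assoc, ← mul_assoc, h1, zero_mul]
    have hdx : star d * x = 0 := by simpa using congrArg star hxd
    have hdt : d * (1 - t) = d := by
      have h1 : (p - t) * (1 - t) = p - t := by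
        rw [mul_sub, mul_one, sub_mul, hpt, htt, sub_self, sub_zero]
      rw [hd, mul_assoc, h1]
    -- scaling makes `d` a contraction
    set r : ℂ := ((1 + ‖d‖ : ℝ) : ℂ)⁻¹ with hr
    have hr0 : r ≠ 0 := by
      rw [hr]
      exact inv_ne_zero (by exact_mod_cast (by positivity : (1 + ‖d‖ : ℝ) ≠ 0))
    have hrd : ‖r • d‖ ≤ 1 := by
      rw [norm_smul, hr, norm_inv, Complex.norm_real, Real.norm_of_nonneg (by positivity),
        inv_mul_le_one₀ (by positivity)]
      linarith
    -- `d'` lives on the kernel of `t` and maps into the orthocomplement of the range of `x`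
    have hle : ∀ d' : L →L[ℂ] L, ‖d'‖ ≤ 1 → star x * d' = 0 → d' * (1 - t) = d' →
        ‖x + d'‖ ≤ 1 := by
      intro d' h1 h2 h3
      have h4 : star d' * x = 0 := by simpa using congrArg star h2
      refine norm_le_one_of_star_mul_self_add (a := 1 - t) (b := d') ?_ fun ξ => ?_
      · rw [star_add, add_mul, mul_add, mul_add, h2, h4, star_sub, hts, star_one, ← ht, sub_mul,
          mul_sub, mul_sub, htt]
        simp only [mul_one, one_mul]
        abel
      · conv_lhs => rw [← h3]
        simpa using d'.le_of_opNorm_le h1 ((1 - t) ξ)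
    have h0 : r • d = 0 := by
      refine hext _ (S.toStarSubalgebra.smul_mem hdS _) (by rw [mul_smul_comm, smul_mul_assoc, hqd])
        (hle _ hrd (by rw [mul_smul_comm, hxd, smul_zero]) (by rw [smul_mul_assoc, hdt])) ?_
      rw [sub_eq_add_neg]
      refine hle _ (by rwa [norm_neg]) ?_ ?_
      · rw [mul_neg, mul_smul_comm, hxd, smul_zero, neg_zero]
      · rw [neg_mul, smul_mul_assoc, hdt]
    exact (smul_eq_zero.1 h0).resolve_left hr0
  rcases eq_zero_or_eq_zero_of_corner S hS (sub_mem hpS htS) hcorner with h | h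
  · exact Or.inr ⟨star x, hxS', by rw [star_star]; exact (sub_eq_zero.1 h).symm, hpx⟩
  · exact Or.inl ⟨x, hxS, (sub_eq_zero.1 h).symm, hqx⟩

end Comparison

/-! ### The commutation theorem for a trace -/

section GNS

variable {A : Type u} [Ring A] [StarRing A] [Algebra ℂ A]
  {L : Type v} [NormedAddCommGroup L] [InnerProductSpace ℂ L] [CompleteSpace L]
  {τ : A →ₗ[ℂ] ℂ} {π : A →⋆ₐ[ℂ] (L →L[ℂ] L)} {Ω : L}

/-- The map `a ↦ â = π(a)Ω` of `A` to its GNS space. -/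
def gnsMap (π : A →⋆ₐ[ℂ] (L →L[ℂ] L)) (Ω : L) : A →ₗ[ℂ] L where
  toFun a := π a Ω
  map_add' a b := by simp
  map_smul' c a := by simp

theorem gnsMap_apply (a : A) : gnsMap π Ω a = π a Ω := rfl

theorem rep_apply_gnsMap (a b : A) : π a (gnsMap π Ω b) = gnsMap π Ω (a * b) := by
  simp [gnsMap_apply]

theorem gnsMap_one : gnsMap π Ω (1 : A) = Ω := by simp [gnsMap_apply]

namespace IsGNS

variable (h : IsGNS τ π Ω)
include h

theorem denseRange : DenseRange (gnsMap π Ω) := h.cyclic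

theorem inner_gnsMap (a b : A) :
    inner ℂ (gnsMap π Ω a) (gnsMap π Ω b) = τ (star a * b) := by
  rw [← h.vector_state, gnsMap_apply, gnsMap_apply, map_mul, map_star,
    ContinuousLinearMap.star_eq_adjoint, mul_apply_eq_comp,
    ContinuousLinearMap.adjoint_inner_right]

theorem norm_gnsMap_sq (a : A) : ‖gnsMap π Ω a‖ ^ 2 = (τ (star a * a)).re := by
  rw [← h.inner_gnsMap, inner_self_eq_norm_sq_to_K]
  norm_cast

theorem eq_of_inner {ξ η : L}
    (hab : ∀ a, inner ℂ (gnsMap π Ω a) ξ = inner ℂ (gnsMap π Ω a) η) : ξ = η :=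
  Dense.eq_of_inner_right ℂ h.cyclic (by rintro _ ⟨a, rfl⟩; exact hab a)

theorem clm_ext {F : Type*} [NormedAddCommGroup F] [InnerProductSpace ℂ F]
    {S T : L →L[ℂ] F} (hST : ∀ a, S (gnsMap π Ω a) = T (gnsMap π Ω a)) : S = T :=
  DFunLike.coe_injective (h.denseRange.equalizer S.continuous T.continuous (funext hST))

theorem exists_seq (ξ : L) :
    ∃ x : ℕ → A, Filter.Tendsto (fun n => gnsMap π Ω (x n)) Filter.atTop (nhds ξ) := by
  obtain ⟨y, hy, hlim⟩ := mem_closure_iff_seq_limit.1 (h.denseRange ξ)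
  choose x hx using hy
  exact ⟨x, by simpa [hx] using hlim⟩

/-- A linear map on `A` that is bounded in the `2`-norm extends to `L²(A)`. -/
theorem exists_extension {F : Type*} [NormedAddCommGroup F] [InnerProductSpace ℂ F]
    [CompleteSpace F] (f : A →ₗ[ℂ] F) (C : ℝ) (hf : ∀ a, ‖f a‖ ≤ C * ‖gnsMap π Ω a‖) :
    ∃ T : L →L[ℂ] F, ∀ a, T (gnsMap π Ω a) = f a :=
  ⟨f.extendOfNorm (gnsMap π Ω), LinearMap.extendOfNorm_eq h.denseRange ⟨C, hf⟩⟩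

end IsGNS

/-- `R` is the operator of right multiplication by `b` on `L²(A)`. -/
def IsRightMul (π : A →⋆ₐ[ℂ] (L →L[ℂ] L)) (Ω : L) (b : A) (R : L →L[ℂ] L) : Prop :=
  ∀ a, R (gnsMap π Ω a) = gnsMap π Ω (a * b)

namespace IsGNS

theorem commute_rightMul (h : IsGNS τ π Ω) {b : A} {R : L →L[ℂ] L} (hR : IsRightMul π Ω b R)
    (a : A) : R * π a = π a * R := by
  refine h.clm_ext fun c => ?_
  simp only [mul_apply_eq_comp, rep_apply_gnsMap, hR _, mul_assoc]

theorem isRightMul_star (h : IsGNS τ π Ω) {b : A} (hb : ∀ a, τ (a * star b) = τ (star b * a))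
    {R : L →L[ℂ] L} (hR : IsRightMul π Ω b R) : IsRightMul π Ω (star b) (star R) := by
  intro a
  refine h.eq_of_inner fun c => ?_
  rw [ContinuousLinearMap.star_eq_adjoint, ContinuousLinearMap.adjoint_inner_right, hR,
    h.inner_gnsMap, h.inner_gnsMap, star_mul, mul_assoc, ← hb, mul_assoc]

theorem norm_gnsMap_star (h : IsGNS τ π Ω) (hτ : IsFaithfulTrace τ) (a : A) :
    ‖gnsMap π Ω (star a)‖ = ‖gnsMap π Ω a‖ := by
  rw [← sq_eq_sq₀ (norm_nonneg _) (norm_nonneg _), h.norm_gnsMap_sq, h.norm_gnsMap_sq,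
    hτ.tracial, star_star]

theorem norm_gnsMap_mul_le (h : IsGNS τ π Ω) (hτ : IsFaithfulTrace τ) (a b : A) :
    ‖gnsMap π Ω (a * b)‖ ≤ ‖π (star b)‖ * ‖gnsMap π Ω a‖ := by
  rw [← h.norm_gnsMap_star hτ, star_mul, ← rep_apply_gnsMap, ← h.norm_gnsMap_star hτ a]
  exact (π (star b)).le_opNorm _

theorem exists_rightMul (h : IsGNS τ π Ω) {b : A} {C : ℝ}
    (hb : ∀ a, ‖gnsMap π Ω (a * b)‖ ≤ C * ‖gnsMap π Ω a‖) :
    ∃ R, IsRightMul π Ω b R :=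
  h.exists_extension (gnsMap π Ω ∘ₗ LinearMap.mulRight ℂ b) C hb

/-- The conjugation `â ↦ (a⋆)^` is continuous and sends `XΩ` to `X⋆Ω` if `X` commutes with the
left or with the right multiplications; both cases are covered by the hypothesis `hX`. -/
theorem tendsto_star (h : IsGNS τ π Ω) (hτ : IsFaithfulTrace τ) {X : L →L[ℂ] L}
    (hX : ∀ a, inner ℂ Ω (X (gnsMap π Ω a)) = inner ℂ (gnsMap π Ω (star a)) (X Ω)) {x : ℕ → A}
    (hx : Filter.Tendsto (fun n => gnsMap π Ω (x n)) Filter.atTop (nhds (X Ω))) :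
    Filter.Tendsto (fun n => gnsMap π Ω (star (x n))) Filter.atTop (nhds ((star X) Ω)) := by
  have hc : CauchySeq fun n => gnsMap π Ω (star (x n)) := by
    have hx' := hx.cauchySeq
    rw [Metric.cauchySeq_iff] at hx' ⊢
    intro ε hε
    obtain ⟨N, hN⟩ := hx' ε hε
    refine ⟨N, fun m hm n hn => ?_⟩
    have := hN m hm n hn
    rwa [dist_eq_norm, ← map_sub, ← star_sub, h.norm_gnsMap_star hτ, map_sub, ← dist_eq_norm]
  obtain ⟨ζ, hζ⟩ := cauchySeq_tendsto_of_complete hc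
  have : ζ = (star X) Ω := by
    refine h.eq_of_inner fun a => ?_
    have h1 := hζ.inner (𝕜 := ℂ) (tendsto_const_nhds (x := gnsMap π Ω a))
    have h2 := (tendsto_const_nhds (x := gnsMap π Ω (star a))).inner (𝕜 := ℂ) hx
    simp only [h.inner_gnsMap, star_star] at h1 h2
    simp only [hτ.tracial _ a] at h1
    have h3 := tendsto_nhds_unique h1 h2
    rw [← inner_conj_symm, h3, ← hX, ContinuousLinearMap.star_eq_adjoint,
      ContinuousLinearMap.adjoint_inner_right, ← inner_conj_symm (X _)]
  rwa [← this]

/-- The commutation theorem for a trace: an operator that commutes with the right multiplications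
commutes with the commutant of the left multiplications. -/
theorem commute_of_commute_rightMul (h : IsGNS τ π Ω) (hτ : IsFaithfulTrace τ) {S T : L →L[ℂ] L}
    (hT : ∀ a, T * π a = π a * T) (hS : ∀ b R, IsRightMul π Ω b R → S * R = R * S) :
    S * T = T * S := by
  have hR : ∀ b, ∃ R, IsRightMul π Ω b R := fun b =>
    h.exists_rightMul fun a => h.norm_gnsMap_mul_le hτ a b
  choose R hR using hR
  have hRs : ∀ b, IsRightMul π Ω (star b) (star (R b)) := fun b =>
    h.isRightMul_star (fun a => hτ.tracial _ _) (hR b)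
  have hRΩ : ∀ b, R b Ω = gnsMap π Ω b := fun b => by
    have := hR b 1
    rwa [gnsMap_one, one_mul] at this
  have hRsΩ : ∀ b, (star (R b)) Ω = gnsMap π Ω (star b) := fun b => by
    have := hRs b 1
    rwa [gnsMap_one, one_mul] at this
  have hπΩ : ∀ a, π a Ω = gnsMap π Ω a := fun a => rfl
  have hTs : ∀ a, star T * π a = π a * star T := fun a => by
    have := congrArg star (hT (star a))
    simpa [map_star] using this.symm
  have hSs : ∀ b, star S * R b = R b * star S := fun b => by
    have := congrArg star (hS _ _ (hRs b))
    simpa using this.symm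
  obtain ⟨t, ht⟩ := h.exists_seq (T Ω)
  obtain ⟨s, hs⟩ := h.exists_seq (S Ω)
  have ht' := h.tendsto_star hτ (X := T) (fun a => by
    have := DFunLike.congr_fun (hT a) Ω
    simp only [mul_apply_eq_comp, hπΩ] at this
    rw [this, ← ContinuousLinearMap.adjoint_inner_left, ← ContinuousLinearMap.star_eq_adjoint,
      ← map_star, hπΩ]) ht
  have hs' := h.tendsto_star hτ (X := S) (fun a => by
    have := DFunLike.congr_fun (hS a _ (hR a)) Ω
    simp only [mul_apply_eq_comp, hRΩ] at this
    rw [this, ← ContinuousLinearMap.adjoint_inner_left, ← ContinuousLinearMap.star_eq_adjoint,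
      hRsΩ]) hs
  refine h.clm_ext fun a => h.eq_of_inner fun b => ?_
  -- both sides are limits of `τ (b⋆ sₙ a tₙ)`
  have e1 : inner ℂ (gnsMap π Ω b) ((S * T) (gnsMap π Ω a)) =
      inner ℂ (R b ((star S) Ω)) (π a (T Ω)) := by
    have h1 := DFunLike.congr_fun (hSs b) Ω
    have h2 := DFunLike.congr_fun (hT a) Ω
    simp only [mul_apply_eq_comp, hRΩ, hπΩ] at h1 h2
    rw [← h1, ← h2, ContinuousLinearMap.star_eq_adjoint, ContinuousLinearMap.adjoint_inner_left]
    rfl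
  have e2 : inner ℂ (gnsMap π Ω b) ((T * S) (gnsMap π Ω a)) =
      inner ℂ (π b ((star T) Ω)) (R a (S Ω)) := by
    have h1 := DFunLike.congr_fun (hTs b) Ω
    have h2 := DFunLike.congr_fun (hS a _ (hR a)) Ω
    simp only [mul_apply_eq_comp, hRΩ, hπΩ] at h1 h2
    rw [← h1, ← h2, ContinuousLinearMap.star_eq_adjoint, ContinuousLinearMap.adjoint_inner_left]
    rfl
  have l1 := (((R b).continuous.tendsto _).comp hs').inner (𝕜 := ℂ)
    (((π a).continuous.tendsto _).comp ht)
  have l2 := (((π b).continuous.tendsto _).comp ht').inner (𝕜 := ℂ)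
    (((R a).continuous.tendsto _).comp hs)
  rw [e1, e2]
  refine tendsto_nhds_unique l1 (l2.congr fun n => ?_)
  simp only [Function.comp, hR _ _, rep_apply_gnsMap, h.inner_gnsMap, star_mul, star_star]
  rw [mul_assoc, hτ.tracial]
  simp only [mul_assoc]

end IsGNS

/-- On some GNS space of a tracial von Neumann algebra, the operators that commute with the right
multiplications are the left multiplications. -/
theorem exists_gns_of_vonNeumann (hτ : IsFaithfulTrace τ)
    (hvN : ∃ (L : Type u) (_ : NormedAddCommGroup L) (_ : InnerProductSpace ℂ L)
      (_ : CompleteSpace L) (π : A →⋆ₐ[ℂ] (L →L[ℂ] L)) (Ω : L) (S : VonNeumannAlgebra L),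
      IsGNS τ π Ω ∧ Set.range π = (S : Set (L →L[ℂ] L))) :
    ∃ (L : Type u) (_ : NormedAddCommGroup L) (_ : InnerProductSpace ℂ L)
      (_ : CompleteSpace L) (π : A →⋆ₐ[ℂ] (L →L[ℂ] L)) (Ω : L),
      IsGNS τ π Ω ∧ ∀ T : L →L[ℂ] L,
        (∀ b R, IsRightMul π Ω b R → T * R = R * T) → ∃ a, π a = T := by
  obtain ⟨L, i1, i2, i3, π, Ω, S, h, hS⟩ := hvN
  refine ⟨L, i1, i2, i3, π, Ω, h, fun T hT => ?_⟩
  change T ∈ Set.range π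
  rw [hS]
  change T ∈ S
  rw [← VonNeumannAlgebra.commutant_commutant S, VonNeumannAlgebra.mem_commutant_iff]
  intro X hX
  rw [VonNeumannAlgebra.mem_commutant_iff] at hX
  refine (h.commute_of_commute_rightMul hτ (fun a => (hX _ ?_).symm) hT).symm
  change π a ∈ (S : Set (L →L[ℂ] L))
  exact hS ▸ ⟨a, rfl⟩

end GNS

/-! ### The Jones projection of a basic construction -/

section JonesProjection

variable {A : Type u} [Ring A] [StarRing A] [Algebra ℂ A] [StarModule ℂ A]
  {L : Type u} [NormedAddCommGroup L] [InnerProductSpace ℂ L] [CompleteSpace L]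
  {τ : A →ₗ[ℂ] ℂ} {π : A →⋆ₐ[ℂ] (L →L[ℂ] L)} {Ω : L} {B : StarSubalgebra ℂ A}

theorem gnsMap_mem_subspaceOf {b : A} (hb : b ∈ B) : gnsMap π Ω b ∈ subspaceOf π Ω B :=
  Submodule.le_topologicalClosure _ (Submodule.subset_span ⟨b, hb, rfl⟩)

theorem subspaceOf_le {W : Submodule ℂ L} (hW : IsClosed (W : Set L))
    (h : ∀ b ∈ B, gnsMap π Ω b ∈ W) : subspaceOf π Ω B ≤ W := by
  refine Submodule.topologicalClosure_minimal _ ?_ hW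
  rw [Submodule.span_le]
  rintro _ ⟨b, hb, rfl⟩
  exact h b hb

theorem star_jonesProjection : star (jonesProjection π Ω B) = jonesProjection π Ω B :=
  isSelfAdjoint_starProjection _

theorem jonesProjection_mul_self :
    jonesProjection π Ω B * jonesProjection π Ω B = jonesProjection π Ω B :=
  (Submodule.isIdempotentElem_starProjection _)

theorem jonesProjection_apply_mem (ξ : L) : jonesProjection π Ω B ξ ∈ subspaceOf π Ω B := by
  simp [jonesProjection]

theorem jonesProjection_gnsMap {b : A} (hb : b ∈ B) :
    jonesProjection π Ω B (gnsMap π Ω b) = gnsMap π Ω b :=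
  Submodule.starProjection_eq_self_iff.2 (gnsMap_mem_subspaceOf hb)

theorem jonesProjection_commute {T : L →L[ℂ] L}
    (h : ∀ b ∈ B, T (gnsMap π Ω b) ∈ subspaceOf π Ω B)
    (h' : ∀ b ∈ B, (star T) (gnsMap π Ω b) ∈ subspaceOf π Ω B) :
    T * jonesProjection π Ω B = jonesProjection π Ω B * T := by
  have key : ∀ T : L →L[ℂ] L, (∀ b ∈ B, T (gnsMap π Ω b) ∈ subspaceOf π Ω B) →
      ∀ ξ ∈ subspaceOf π Ω B, T ξ ∈ subspaceOf π Ω B := by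
    intro T hT ξ hξ
    have hcl : IsClosed (((subspaceOf π Ω B).comap (T : L →ₗ[ℂ] L) : Submodule ℂ L) : Set L) :=
      (Submodule.isClosed_topologicalClosure _).preimage T.continuous
    exact subspaceOf_le (π := π) hcl hT hξ
  exact starProjection_commute_of_invariant _ (key T h) (key _ h')

theorem rep_commute_jonesProjection {b : A} (hb : b ∈ B) :
    π b * jonesProjection π Ω B = jonesProjection π Ω B * π b := by
  refine jonesProjection_commute (fun c hc => ?_) fun c hc => ?_
  · rw [rep_apply_gnsMap]; exact gnsMap_mem_subspaceOf (mul_mem hb hc)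
  · rw [← map_star, rep_apply_gnsMap]; exact gnsMap_mem_subspaceOf (mul_mem (star_mem hb) hc)

theorem mul_jonesProjection_eq {S T : L →L[ℂ] L}
    (h : ∀ b ∈ B, S (gnsMap π Ω b) = T (gnsMap π Ω b)) :
    S * jonesProjection π Ω B = T * jonesProjection π Ω B := by
  ext ξ
  have hle : subspaceOf π Ω B ≤ LinearMap.ker ((S - T : L →L[ℂ] L) : L →ₗ[ℂ] L) :=
    subspaceOf_le (ContinuousLinearMap.isClosed_ker (S - T)) fun b hb => by simp [h b hb]
  have := hle (jonesProjection_apply_mem ξ)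
  simpa [sub_eq_zero] using this

namespace IsGNS

/-- The Jones projection is given by the conditional expectation: `a₀` is the expectation of `a` if
`τ(b⋆a) = τ(b⋆a₀)` for all `b ∈ B`. -/
theorem jonesProjection_gnsMap_eq (h : IsGNS τ π Ω) {a a₀ : A} (ha₀ : a₀ ∈ B)
    (ha : ∀ b ∈ B, τ (star b * a) = τ (star b * a₀)) :
    jonesProjection π Ω B (gnsMap π Ω a) = gnsMap π Ω a₀ := by
  refine Submodule.eq_starProjection_of_mem_orthogonal (gnsMap_mem_subspaceOf ha₀) ?_
  have hle : subspaceOf π Ω B ≤ (ℂ ∙ (gnsMap π Ω a - gnsMap π Ω a₀))ᗮ := by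
    refine subspaceOf_le (Submodule.isClosed_orthogonal _) fun b hb => ?_
    rw [Submodule.mem_orthogonal_singleton_iff_inner_left, inner_sub_right, h.inner_gnsMap,
      h.inner_gnsMap, ha b hb, sub_self]
  exact (Submodule.mem_orthogonal _ _).2 fun ξ hξ =>
    (Submodule.mem_orthogonal_singleton_iff_inner_left).1 (hle hξ)

/-- `e T e ∈ B e` for every `T` in the basic construction `⟨A, e⟩` of a von Neumann algebra `B ⊆ A`.
The operator `T` commutes with the right multiplications by `B`, so its compression to `L²(B)` is
a left multiplication by the commutation theorem for `B`. The algebra `B` is the range of `i`. -/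
theorem exists_compression_eq (h : IsGNS τ π Ω) {B₀ : Type w} [Ring B₀] [StarRing B₀]
    [Algebra ℂ B₀] {L₀ : Type w} [NormedAddCommGroup L₀] [InnerProductSpace ℂ L₀]
    [CompleteSpace L₀] {π₀ : B₀ →⋆ₐ[ℂ] (L₀ →L[ℂ] L₀)} {Ω₀ : L₀} (i : B₀ →⋆ₐ[ℂ] A)
    (hi : ∀ x, x ∈ B ↔ ∃ b, i b = x)
    (h₀ : IsGNS (τ ∘ₗ i.toAlgHom.toLinearMap) π₀ Ω₀)
    (hleft : ∀ T : L₀ →L[ℂ] L₀,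
      (∀ b R, IsRightMul π₀ Ω₀ b R → T * R = R * T) → ∃ b, π₀ b = T)
    (hcent : ∀ a b, τ (a * i b) = τ (i b * a))
    (hbdd : ∀ b, ∃ C, ∀ a, ‖gnsMap π Ω (a * i b)‖ ≤ C * ‖gnsMap π Ω a‖)
    {T : L →L[ℂ] L} (hT : T ∈ jonesAlgebra π Ω B) :
    ∃ b, jonesProjection π Ω B * T * jonesProjection π Ω B =
      π (i b) * jonesProjection π Ω B := by
  set e := jonesProjection π Ω B with he
  have hiB : ∀ b, i b ∈ B := fun b => (hi _).2 ⟨b, rfl⟩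
  have hinner : ∀ b c, inner ℂ (gnsMap π Ω (i b)) (gnsMap π Ω (i c)) =
      inner ℂ (gnsMap π₀ Ω₀ b) (gnsMap π₀ Ω₀ c) := fun b c => by
    rw [h.inner_gnsMap, h₀.inner_gnsMap, ← map_star, ← map_mul]
    rfl
  have hnorm : ∀ b, ‖gnsMap π Ω (i b)‖ = ‖gnsMap π₀ Ω₀ b‖ := fun b => by
    rw [norm_eq_sqrt_re_inner (𝕜 := ℂ), norm_eq_sqrt_re_inner (𝕜 := ℂ), hinner]
  -- the isometry `U` of `L²(B)` into `L²(A)`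
  obtain ⟨U, hU⟩ := h₀.exists_extension (gnsMap π Ω ∘ₗ i.toAlgHom.toLinearMap) 1
    fun b => by rw [one_mul]; exact (hnorm b).le
  replace hU : ∀ b, U (gnsMap π₀ Ω₀ b) = gnsMap π Ω (i b) := hU
  have hUU : U.adjoint ∘L U = 1 := h₀.clm_ext fun c => h₀.eq_of_inner fun b => by
    rw [ContinuousLinearMap.comp_apply, ContinuousLinearMap.adjoint_inner_right, hU, hU, hinner]
    rfl
  have hUe : U ∘L U.adjoint = e := by
    ext ξ
    refine (Submodule.eq_starProjection_of_mem_orthogonal ?_ ?_).symm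
    · have hcl : IsClosed (((subspaceOf π Ω B).comap (U : L₀ →ₗ[ℂ] L) : Submodule ℂ L₀) :
          Set L₀) := (Submodule.isClosed_topologicalClosure _).preimage U.continuous
      have : ∀ η, U η ∈ subspaceOf π Ω B := fun η => by
        refine h₀.denseRange.induction_on (p := fun η => U η ∈ subspaceOf π Ω B) η hcl ?_
        intro b
        rw [hU]
        exact gnsMap_mem_subspaceOf (hiB b)
      exact this _
    · have hle : subspaceOf π Ω B ≤ (ℂ ∙ (ξ - (U ∘L U.adjoint) ξ))ᗮ := by
        refine subspaceOf_le (Submodule.isClosed_orthogonal _) fun b hb => ?_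
        obtain ⟨b, rfl⟩ := (hi _).1 hb
        rw [Submodule.mem_orthogonal_singleton_iff_inner_left, ← hU,
          ← ContinuousLinearMap.adjoint_inner_right, map_sub, ContinuousLinearMap.comp_apply]
        have := DFunLike.congr_fun hUU (U.adjoint ξ)
        rw [ContinuousLinearMap.comp_apply] at this
        rw [this]
        simp
      exact (Submodule.mem_orthogonal _ _).2 fun ξ hξ =>
        (Submodule.mem_orthogonal_singleton_iff_inner_left).1 (hle hξ)
  have hUπ : ∀ b, U ∘L π₀ b = π (i b) ∘L U := fun b => h₀.clm_ext fun c => by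
    simp only [ContinuousLinearMap.comp_apply, rep_apply_gnsMap, hU, map_mul]
  have hTR : ∀ b R, IsRightMul π Ω (i b) R → T * R = R * T := by
    intro b R hR
    have hRs := h.isRightMul_star (fun a => by rw [← map_star]; exact hcent _ _) hR
    rw [← map_star] at hRs
    have hRe : R * e = e * R := jonesProjection_commute
      (fun c hc => by rw [hR]; exact gnsMap_mem_subspaceOf (mul_mem hc (hiB _)))
      (fun c hc => by rw [hRs]; exact gnsMap_mem_subspaceOf (mul_mem hc (hiB _)))
    refine ((StarSubalgebra.mem_centralizer_iff ℂ).1 hT R ?_).1.symm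
    change R ∈ StarSubalgebra.centralizer ℂ _
    rw [StarSubalgebra.mem_centralizer_iff]
    rintro _ (⟨a, rfl⟩ | rfl)
    · rw [← map_star]
      exact ⟨(h.commute_rightMul hR a).symm, (h.commute_rightMul hR _).symm⟩
    · rw [star_jonesProjection]
      exact ⟨hRe.symm, hRe.symm⟩
  obtain ⟨b, hb⟩ := hleft (U.adjoint ∘L T ∘L U) fun b R₀ hR₀ => by
    obtain ⟨C, hC⟩ := hbdd b
    obtain ⟨R, hR⟩ := h.exists_rightMul hC
    have hRs := h.isRightMul_star (fun a => by rw [← map_star]; exact hcent _ _) hR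
    rw [← map_star] at hRs
    have hRs₀ := h₀.isRightMul_star (fun a => by
      simpa using hcent (i a) (star b)) hR₀
    have h1 : U ∘L R₀ = R ∘L U := h₀.clm_ext fun c => by
      simp only [ContinuousLinearMap.comp_apply, hR₀ _, hU, hR _, map_mul]
    have h2 : U ∘L star R₀ = star R ∘L U := h₀.clm_ext fun c => by
      simp only [ContinuousLinearMap.comp_apply, hRs₀ _, hU, hRs _, map_mul]
    have h3 : R₀ ∘L U.adjoint = U.adjoint ∘L R := by
      have := congrArg ContinuousLinearMap.adjoint h2
      simpa [ContinuousLinearMap.adjoint_comp, ContinuousLinearMap.star_eq_adjoint] using this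
    change (U.adjoint ∘L T ∘L U) ∘L R₀ = R₀ ∘L (U.adjoint ∘L T ∘L U)
    rw [← ContinuousLinearMap.comp_assoc R₀, h3, ContinuousLinearMap.comp_assoc,
      ContinuousLinearMap.comp_assoc, h1, ContinuousLinearMap.comp_assoc,
      ← ContinuousLinearMap.comp_assoc R T, ← ContinuousLinearMap.comp_assoc T R]
    congr 2
    exact hTR b R hR
  refine ⟨b, ?_⟩
  change (e ∘L T) ∘L e = π (i b) ∘L e
  rw [← hUe, ← ContinuousLinearMap.comp_assoc (π (i b)) U U.adjoint, ← hUπ, hb]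
  simp only [ContinuousLinearMap.comp_assoc]

end IsGNS

/-- The properties of the Jones projection `E` of a basic construction `A → C` for `B ⊆ A`, where the
von Neumann algebra `B` is the range of `i`. The last three say that the cyclic vector separates
`A`, that `E a E = 0` if `a` has conditional expectation `0`, and that elements `l k` for which
`a = ∑ l k E_B((l k)⋆ a)` form a basis of `A` over `B`. The trace property is needed only for
products with elements of `B`. -/
theorem IsBasicConstruction.exists_projection {C : Type*} [Ring C] [StarRing C] [Algebra ℂ C]
    {ι : A →⋆ₐ[ℂ] C} (hC : IsBasicConstruction τ B ι)
    (hτ : ∀ a, τ (star a * a) = 0 → a = 0)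
    {B₀ : Type w} [Ring B₀] [StarRing B₀] [Algebra ℂ B₀] (i : B₀ →⋆ₐ[ℂ] A)
    (hi : ∀ x, x ∈ B ↔ ∃ b, i b = x)
    {τ₀ : B₀ →ₗ[ℂ] ℂ} (hτ₀ : ∀ b, τ₀ b = τ (i b)) (htr₀ : IsFaithfulTrace τ₀)
    (hvN : ∃ (L : Type w) (_ : NormedAddCommGroup L) (_ : InnerProductSpace ℂ L)
      (_ : CompleteSpace L) (π : B₀ →⋆ₐ[ℂ] (L →L[ℂ] L)) (Ω : L) (S : VonNeumannAlgebra L),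
      IsGNS τ₀ π Ω ∧ Set.range π = (S : Set (L →L[ℂ] L)))
    (hcent : ∀ a b, τ (a * i b) = τ (i b * a))
    (hbdd : ∀ b, ∃ C : ℝ, 0 ≤ C ∧ ∀ a, (τ (star (a * i b) * (a * i b))).re ≤
      C ^ 2 * (τ (star a * a)).re) :
    ∃ E : C, star E = E ∧ E * E = E ∧ (∀ b, ι (i b) * E = E * ι (i b)) ∧
      (∀ c, ∃ b, E * c * E = ι (i b) * E) ∧
      (∀ a, ι a * E = E → a = 1) ∧
      (∀ a, (∀ b b', τ (star (i b) * a * i b') = 0) → E * ι a * E = 0) ∧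
      (∀ {κ : Type v} [Fintype κ] (l : κ → A), (∀ a, ∃ x : κ → B₀,
        (∀ k b, τ (star (i b) * (star (l k) * a)) = τ (star (i b) * i (x k))) ∧
        ∑ k, l k * i (x k) = a) → ∑ k, ι (l k) * E * star (ι (l k)) = 1) := by
  obtain ⟨L, _, _, _, π, Ω, h, Φ, hΦ⟩ := hC
  obtain ⟨L₀, _, _, _, π₀, Ω₀, h₀, hleft⟩ := exists_gns_of_vonNeumann htr₀ hvN
  have hτ' : τ₀ = τ ∘ₗ i.toAlgHom.toLinearMap := LinearMap.ext hτ₀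
  subst hτ'
  have hiB : ∀ b, i b ∈ B := fun b => (hi _).2 ⟨b, rfl⟩
  have hmem : jonesProjection π Ω B ∈ (jonesAlgebra π Ω B).toStarSubalgebra := by
    change jonesProjection π Ω B ∈ StarSubalgebra.centralizer ℂ _
    rw [StarSubalgebra.mem_centralizer_iff]
    intro g hg
    have hg' : g ∈ StarSubalgebra.centralizer ℂ _ := hg
    rw [StarSubalgebra.mem_centralizer_iff] at hg'
    have h1 := (hg' _ (Or.inr rfl)).1
    have h2 := congrArg star h1
    simp only [star_mul, star_jonesProjection] at h2
    exact ⟨h1.symm, h2⟩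
  set E : C := Φ.symm ⟨_, hmem⟩ with hE
  have hΦE : (Φ E : L →L[ℂ] L) = jonesProjection π Ω B := by rw [hE, Φ.apply_symm_apply]
  have hinj : ∀ {x y : C}, (Φ x : L →L[ℂ] L) = Φ y → x = y := fun hxy =>
    Φ.injective (Subtype.ext hxy)
  refine ⟨E, ?_, ?_, ?_, ?_, ?_, ?_, ?_⟩
  · refine hinj ?_
    rw [map_star]
    simp [hΦE, star_jonesProjection]
  · refine hinj ?_
    simp [hΦE, jonesProjection_mul_self]
  · intro b
    refine hinj ?_
    simp [hΦE, hΦ, rep_commute_jonesProjection (hiB b)]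
  · intro c
    obtain ⟨b, hb⟩ := h.exists_compression_eq i hi h₀ hleft hcent (fun b => by
      obtain ⟨C, hC, hb⟩ := hbdd b
      refine ⟨C, fun a => le_of_sq_le_sq ?_ (by positivity)⟩
      rw [mul_pow, h.norm_gnsMap_sq, h.norm_gnsMap_sq]
      exact hb a) (Φ c).2
    refine ⟨b, hinj ?_⟩
    simpa [hΦE, hΦ] using hb
  · intro a ha
    have h1 := congrArg (fun x => (Φ x : L →L[ℂ] L)) ha
    simp only [map_mul, MulMemClass.coe_mul, hΦE, hΦ] at h1
    have h2 := DFunLike.congr_fun h1 (gnsMap π Ω 1)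
    rw [mul_apply_eq_comp, jonesProjection_gnsMap (one_mem B), rep_apply_gnsMap, mul_one,
      ← sub_eq_zero, ← map_sub] at h2
    refine sub_eq_zero.1 (hτ _ ?_)
    rw [← h.inner_gnsMap, h2, inner_zero_left]
  · intro a ha
    refine hinj ?_
    simp only [map_mul, map_zero, MulMemClass.coe_mul, hΦE, hΦ, ZeroMemClass.coe_zero]
    rw [← zero_mul (jonesProjection π Ω B)]
    refine mul_jonesProjection_eq fun b hb => ?_
    obtain ⟨b, rfl⟩ := (hi _).1 hb
    rw [mul_apply_eq_comp, rep_apply_gnsMap, h.jonesProjection_gnsMap_eq (zero_mem B), map_zero]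
    · simp
    · intro c hc
      obtain ⟨c, rfl⟩ := (hi _).1 hc
      rw [← mul_assoc, ha, mul_zero, map_zero]
  · intro κ _ l hl
    refine hinj ?_
    simp only [map_sum, map_mul, map_star, map_one, AddSubmonoidClass.coe_finsetSum,
      MulMemClass.coe_mul, StarMemClass.coe_star, OneMemClass.coe_one, hΦE, hΦ]
    refine h.clm_ext fun a => ?_
    obtain ⟨x, hx, hsum⟩ := hl a
    conv_rhs => rw [← hsum]
    rw [one_apply_eq_self, sum_apply, map_sum]
    refine Finset.sum_congr rfl fun k _ => ?_
    rw [← map_star, mul_apply_eq_comp, mul_apply_eq_comp, rep_apply_gnsMap,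
      h.jonesProjection_gnsMap_eq (hiB (x k)), rep_apply_gnsMap]
    intro b hb
    obtain ⟨b, rfl⟩ := (hi _).1 hb
    exact hx k b

end JonesProjection

/-! ### Projections and intertwiners in a II₁ factor -/

section Traces

variable {P : Type u} [Ring P] [StarRing P] [Algebra ℂ P] {τ : P →ₗ[ℂ] ℂ}

namespace IsFaithfulTrace

variable (hτ : IsFaithfulTrace τ)
include hτ

theorem eq_zero_of_re_le {a : P} (h : (τ (star a * a)).re ≤ 0) : a = 0 := by
  refine hτ.faithful a ?_
  have h1 := Complex.nonneg_iff.1 (hτ.nonneg a)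
  exact Complex.ext (le_antisymm h h1.1) h1.2.symm

/-- In a tracial algebra `v` is a partial isometry if `v⋆v` is a projection. -/
theorem mul_star_mul_self {v p : P} (hv : star v * v = p) (hp : p * p = p) : v * p = v := by
  have hps : star p = p := by rw [← hv]; simp
  have h : star (v * p - v) * (v * p - v) = 0 := by
    rw [star_sub, star_mul, hps, sub_mul, mul_sub, mul_sub, mul_assoc p, ← mul_assoc (star v), hv,
      mul_assoc p, hv, hp, hp, sub_self]
  exact sub_eq_zero.1 (hτ.faithful _ (by rw [h, map_zero]))

/-- If `v` maps `p` into `q`, then `q - v v⋆` is a projection of trace `τ(q) - τ(p)`. -/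
theorem remainder {v p q : P} (hv : star v * v = p) (hp : p * p = p) (hqv : q * v = v)
    (hq : star q = q) (hqq : q * q = q) :
    star (q - v * star v) * (q - v * star v) = q - v * star v ∧
      star (q - v * star v) = q - v * star v ∧ τ (q - v * star v) = τ q - τ p := by
  have hvp := hτ.mul_star_mul_self hv hp
  have hvq : star v * q = star v := by simpa [hq] using congrArg star hqv
  have hs : star (q - v * star v) = q - v * star v := by simp [hq]
  refine ⟨?_, hs, by rw [map_sub, hτ.tracial v, hv]⟩
  rw [hs, mul_sub, sub_mul, sub_mul, hqq, mul_assoc v _ q, hvq, ← mul_assoc q, hqv,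
    mul_assoc v _ (v * star v), ← mul_assoc (star v), hv, ← mul_assoc v p, hvp]
  abel

end IsFaithfulTrace

/-- Averaging over a finite group of automorphisms gives an invariant trace. -/
theorem exists_invariant_trace (hτ : IsFaithfulTrace τ) {G : Type v} [Group G] [Fintype G]
    (σ : G →* (P ≃⋆ₐ[ℂ] P)) :
    ∃ t : P →ₗ[ℂ] ℂ, IsFaithfulTrace t ∧ ∀ g x, t (σ g x) = t x := by
  let f : G → P →ₗ[ℂ] ℂ := fun g => τ ∘ₗ (σ g).toAlgEquiv.toLinearMap
  have hf : ∀ g x, f g x = τ (σ g x) := fun _ _ => rfl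
  have hc : (0 : ℝ) < (Fintype.card G : ℝ)⁻¹ := by positivity
  let t : P →ₗ[ℂ] ℂ := (((Fintype.card G : ℝ)⁻¹ : ℝ) : ℂ) • ∑ g, f g
  have ht : ∀ x, t x = (((Fintype.card G : ℝ)⁻¹ : ℝ) : ℂ) * ∑ g, τ (σ g x) := fun x => by
    simp [t, hf]
  have hnn : ∀ a g, 0 ≤ τ (σ g (star a * a)) := fun a g => by
    rw [map_mul, map_star]; exact hτ.nonneg _
  refine ⟨t, ⟨?_, fun a => ?_, fun a ha => ?_, fun a b => ?_⟩, fun g x => ?_⟩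
  · simp [ht, hτ.map_one]
  · rw [ht]
    exact mul_nonneg (by exact_mod_cast hc.le) (Finset.sum_nonneg fun g _ => hnn a g)
  · rw [ht, mul_eq_zero] at ha
    have h1 := ha.resolve_left (by exact_mod_cast hc.ne')
    have h2 := (Finset.sum_eq_zero_iff_of_nonneg fun g _ => hnn a g).1 h1 1 (Finset.mem_univ _)
    rw [map_one] at h2
    exact hτ.faithful a h2
  · simp_rw [ht, map_mul, fun g => hτ.tracial (σ g a)]
  · rw [ht, ht]
    congr 1
    exact Fintype.sum_equiv (Equiv.mulRight g) _ _ fun h => by simp [map_mul]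

namespace IsIIOneFactor

variable (hP : IsIIOneFactor τ)
include hP

theorem exists_smul_one {z : P} (hz : ∀ x, z * x = x * z) : ∃ c : ℂ, z = c • 1 := by
  have : z ∈ Subalgebra.center ℂ P := Subalgebra.mem_center_iff.2 fun x => (hz x).symm
  rw [hP.center_trivial, Algebra.mem_bot] at this
  obtain ⟨c, hc⟩ := this
  exact ⟨c, by rw [← hc, Algebra.algebraMap_eq_smul_one]⟩

/-- Right multiplications are bounded in the `2`-norm. -/
theorem exists_bound (b : P) : ∃ C : ℝ, 0 ≤ C ∧ ∀ a, (τ (star (a * b) * (a * b))).re ≤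
    C ^ 2 * (τ (star a * a)).re := by
  obtain ⟨L, _, _, _, π, Ω, S, h, -⟩ := hP.vonNeumann
  refine ⟨‖π (star b)‖, norm_nonneg _, fun a => ?_⟩
  rw [← h.norm_gnsMap_sq, ← h.norm_gnsMap_sq, ← mul_pow]
  exact pow_le_pow_left₀ (norm_nonneg _) (h.norm_gnsMap_mul_le hP.trace a b) 2

theorem exists_comparison {p q : P} (hp : star p = p) (hpp : p * p = p) (hq : star q = q)
    (hqq : q * q = q) :
    (∃ v, star v * v = p ∧ q * v = v) ∨ (∃ v, star v * v = q ∧ p * v = v) := by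
  obtain ⟨L, _, _, _, π, Ω, S, h, hS⟩ := hP.vonNeumann
  have hmem : ∀ T, T ∈ S ↔ ∃ x, π x = T := fun T => by
    change T ∈ (S : Set (L →L[ℂ] L)) ↔ _
    rw [← hS]; rfl
  have hinj : Function.Injective π := by
    intro x y hxy
    refine sub_eq_zero.1 (hP.trace.faithful _ ?_)
    rw [← h.inner_gnsMap, gnsMap_apply, map_sub, hxy, sub_self]
    simp
  have hπ : ∀ x, π x ∈ S := fun x => (hmem _).2 ⟨x, rfl⟩
  have hfac : ∀ z ∈ S, z ∈ S.commutant → ∃ c : ℂ, z = c • 1 := by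
    intro z hz hz'
    obtain ⟨x, rfl⟩ := (hmem z).1 hz
    rw [VonNeumannAlgebra.mem_commutant_iff] at hz'
    obtain ⟨c, rfl⟩ := hP.exists_smul_one (z := x) fun y => hinj (by
      rw [map_mul, map_mul]; exact (hz' _ (hπ y)).symm)
    exact ⟨c, by rw [map_smul, map_one]⟩
  have key : ∀ {p q : P}, (∃ v ∈ S, star v * v = π p ∧ π q * v = v) →
      ∃ v, star v * v = p ∧ q * v = v := by
    rintro p q ⟨v, hv, h1, h2⟩
    obtain ⟨x, rfl⟩ := (hmem v).1 hv
    exact ⟨x, hinj (by rw [map_mul, map_star, h1]), hinj (by rw [map_mul, h2])⟩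
  exact (exists_comparison_of_factor S hfac (hπ p) (hπ q) (by rw [← map_star, hp])
    (by rw [← map_mul, hpp]) (by rw [← map_star, hq]) (by rw [← map_mul, hqq])).imp key key

/-- A projection is equivalent to its images under a finite group of automorphisms: the two
projections are comparable, and an invariant trace shows that neither can be strictly smaller. -/
theorem exists_equivalence {G : Type v} [Group G] [Fintype G] (σ : G →* (P ≃⋆ₐ[ℂ] P)) (g : G)
    {p : P} (hp : star p = p) (hpp : p * p = p) :
    ∃ v, star v * v = p ∧ v * star v = σ g p := by
  obtain ⟨t, ht, hinv⟩ := exists_invariant_trace hP.trace σ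
  have key : ∀ {p q v : P}, star v * v = p → p * p = p → q * v = v → star q = q → q * q = q →
      t p = t q → v * star v = q := by
    intro p q v hv hpp hqv hq hqq htr
    obtain ⟨h1, -, h3⟩ := ht.remainder hv hpp hqv hq hqq
    have : q - v * star v = 0 := ht.faithful _ (by rw [h1, h3, htr, sub_self])
    exact (sub_eq_zero.1 this).symm
  have hq : star (σ g p) = σ g p := by rw [← map_star, hp]
  have hqq : σ g p * σ g p = σ g p := by rw [← map_mul, hpp]
  rcases hP.exists_comparison hp hpp hq hqq with ⟨v, h1, h2⟩ | ⟨v, h1, h2⟩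
  · exact ⟨v, h1, key h1 hpp h2 hq hqq (hinv g p).symm⟩
  · exact ⟨star v, by rw [star_star]; exact key h1 hqq h2 hp hpp (hinv g p),
      by rw [star_star, h1]⟩

/-- A II₁ factor is generated as an ideal by any nonzero projection. -/
theorem exists_sum_eq_one {e : P} (he : star e = e) (hee : e * e = e) (he0 : e ≠ 0) :
    ∃ (n : ℕ) (a b : Fin n → P), ∑ i, a i * e * b i = 1 := by
  have hpos : 0 < (τ e).re := by
    by_contra hle
    refine he0 (hP.trace.eq_zero_of_re_le ?_)
    rw [he, hee]
    exact not_lt.1 hle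
  have main : ∀ (m : ℕ) (p : P), star p = p → p * p = p → (τ p).re ≤ m * (τ e).re →
      ∃ (n : ℕ) (a b : Fin n → P), ∑ i, a i * e * b i = p := by
    intro m
    induction m with
    | zero =>
      intro p hp hpp hle
      have : p = 0 := hP.trace.eq_zero_of_re_le (by simpa [hp, hpp] using hle)
      exact ⟨0, Fin.elim0, Fin.elim0, by simp [this]⟩
    | succ m ih =>
      intro p hp hpp hle
      rcases hP.exists_comparison hp hpp he hee with ⟨v, h1, h2⟩ | ⟨v, h1, h2⟩
      · exact ⟨1, fun _ => star v, fun _ => v, by simp [mul_assoc, h1, h2]⟩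
      · obtain ⟨h3, h4, h5⟩ := hP.trace.remainder h1 hee h2 hp hpp
        rw [h4] at h3
        obtain ⟨n, a, b, hab⟩ := ih _ h4 h3 (by
          rw [h5, Complex.sub_re]; push_cast at hle; linarith)
        refine ⟨n + 1, Fin.cons v a, Fin.cons (star v) b, ?_⟩
        rw [Fin.sum_univ_succ]
        simp [hab, hP.trace.mul_star_mul_self h1 hee]
  obtain ⟨m, hm⟩ := exists_nat_ge ((τ 1).re / (τ e).re)
  exact main m 1 (star_one _) (mul_one _) ((div_le_iff₀ hpos).1 hm)

/-- There is no nonzero intertwiner between the identity of a II₁ factor and an outer automorphism: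
`w w⋆` and `w⋆ w` are central, so `w` would be a multiple of a unitary implementing `α`. -/
theorem eq_zero_of_intertwines [StarModule ℂ P] {α : P ≃⋆ₐ[ℂ] P} {w : P} (hw : ∀ x, x * w = w * α x)
    (hα : ∀ u : unitary P, α ≠ Unitary.conjStarAlgAut ℂ P u) : w = 0 := by
  by_contra hw0
  have hws : ∀ x, star w * x = α x * star w := fun x => by
    simpa [← map_star] using congrArg star (hw (star x))
  obtain ⟨c, hc⟩ := hP.exists_smul_one (z := w * star w) fun x => by
    rw [mul_assoc, hws, ← mul_assoc, ← hw, mul_assoc]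
  obtain ⟨d, hd⟩ := hP.exists_smul_one (z := star w * w) fun x => by
    obtain ⟨y, rfl⟩ : ∃ y, α y = x := ⟨α.symm x, α.apply_symm_apply x⟩
    rw [mul_assoc, ← hw, ← mul_assoc, hws, mul_assoc]
  have hcd : c = d := by
    have h1 := hP.trace.tracial w (star w)
    rw [hc, hd] at h1
    simpa [hP.trace.map_one] using h1
  subst hcd
  have hτc : τ (star w * w) = c := by rw [hd]; simp [hP.trace.map_one]
  have hc0 : c ≠ 0 := fun h => hw0 (hP.trace.faithful _ (by rw [hτc, h]))
  have hcn : 0 ≤ c := hτc ▸ hP.trace.nonneg w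
  obtain ⟨r, hr, rfl⟩ : ∃ r : ℝ, 0 ≤ r ∧ (r : ℂ) = c :=
    ⟨c.re, (Complex.nonneg_iff.1 hcn).1, Complex.ext rfl (Complex.nonneg_iff.1 hcn).2⟩
  have hr0 : r ≠ 0 := by simpa using hc0
  set s : ℂ := (((Real.sqrt r)⁻¹ : ℝ) : ℂ) with hs
  have hss : s * s * (r : ℂ) = 1 := by
    rw [hs, ← Complex.ofReal_mul, ← Complex.ofReal_mul, ← mul_inv, Real.mul_self_sqrt hr,
      inv_mul_cancel₀ hr0, Complex.ofReal_one]
  have hs' : star s = s := Complex.conj_ofReal _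
  have hu : s • star w ∈ unitary P := by
    rw [Unitary.mem_iff, star_smul, star_star, hs']
    constructor
    · rw [smul_mul_smul_comm, hc, smul_smul, hss, one_smul]
    · rw [smul_mul_smul_comm, hd, smul_smul, hss, one_smul]
  refine hα ⟨_, hu⟩ (StarAlgEquiv.ext fun x => ?_)
  rw [Unitary.conjStarAlgAut_apply]
  change α x = s • star w * x * star (s • star w)
  rw [star_smul, star_star, hs', smul_mul_assoc, smul_mul_assoc, mul_smul_comm, smul_smul,
    hws, mul_assoc, hd, mul_smul_comm, mul_one, smul_smul, hss, one_smul]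

end IsIIOneFactor

end Traces

/-! ### Matrix units -/

section MatrixAlgebra

/-- A `*`-algebra `C` with matrix units `l k * e * star (l m)` and corner `e C e = Q e` is the
algebra of matrices over `Q`. -/
theorem exists_matrixEquiv {Q : Type*} [Ring Q] [StarRing Q] [Algebra ℂ Q] {C : Type*} [Ring C]
    [StarRing C] [Algebra ℂ C] {κ : Type*} [Fintype κ] [DecidableEq κ] (i : Q →⋆ₐ[ℂ] C)
    {e : C} (l : κ → C) (he : star e = e) (hee : e * e = e) (hcomm : ∀ q, i q * e = e * i q)
    (hl : ∀ k m, e * star (l k) * (l m * e) = if k = m then e else 0)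
    (hsum : ∑ k, l k * e * star (l k) = 1) (hcorner : ∀ c, ∃ q, e * c * e = i q * e)
    (hinj : ∀ q, i q * e = 0 → q = 0) :
    ∃ Ψ : Matrix κ κ Q ≃⋆ₐ[ℂ] C, ∀ d : κ → Q,
      Ψ (Matrix.diagonal d) = ∑ k, l k * (i (d k) * e) * star (l k) := by
  have hmul : ∀ q r k m k' m', l k * (i q * e) * star (l m) * (l k' * (i r * e) * star (l m')) =
      if m = k' then l k * (i (q * r) * e) * star (l m') else 0 := by
    intro q r k m k' m'
    have : l k * (i q * e) * star (l m) * (l k' * (i r * e) * star (l m')) =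
        l k * i q * (e * star (l m) * (l k' * e)) * i r * star (l m') := by
      rw [hcomm r]; simp only [mul_assoc]
    rw [this, hl]
    split_ifs
    · rw [map_mul, mul_assoc (i q), hcomm r]; simp only [mul_assoc]
    · simp
  let F : Matrix κ κ Q →⋆ₙₐ[ℂ] C :=
    { toFun := fun X => ∑ k, ∑ m, l k * (i (X k m) * e) * star (l m)
      map_smul' := fun c X => by simp [Finset.smul_sum]
      map_zero' := by simp
      map_add' := fun X Y => by simp [add_mul, mul_add, Finset.sum_add_distrib]
      map_mul' := fun X Y => by
        have h1 : ∀ k n, l k * (i (X k n) * e) * star (l n) *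
            (∑ k', ∑ m, l k' * (i (Y k' m) * e) * star (l m)) =
            ∑ m, l k * (i (X k n * Y n m) * e) * star (l m) := by
          intro k n
          simp only [Finset.mul_sum, hmul]
          rw [Finset.sum_comm]
          simp
        rw [Finset.sum_mul]
        refine Finset.sum_congr rfl fun k _ => ?_
        rw [Finset.sum_mul]
        simp only [h1]
        rw [Finset.sum_comm]
        refine Finset.sum_congr rfl fun m _ => ?_
        rw [Matrix.mul_apply, map_sum, Finset.sum_mul, Finset.mul_sum, Finset.sum_mul]
      map_star' := fun X => by
        simp only [star_sum, star_mul, star_star, he, Matrix.star_apply, map_star]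
        rw [Finset.sum_comm]
        refine Finset.sum_congr rfl fun k _ => Finset.sum_congr rfl fun m _ => ?_
        rw [← map_star, ← hcomm]
        simp only [mul_assoc] }
  have hF : ∀ X, F X = ∑ k, ∑ m, l k * (i (X k m) * e) * star (l m) := fun _ => rfl
  have hentry : ∀ X k m, e * star (l k) * F X * (l m * e) = i (X k m) * e := by
    intro X k m
    have h1 : ∀ a b, e * star (l k) * (l a * (i (X a b) * e) * star (l b)) * (l m * e) =
        if k = a then (if b = m then i (X k m) * e else 0) else 0 := by
      intro a b
      have : e * star (l k) * (l a * (i (X a b) * e) * star (l b)) * (l m * e) =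
          (e * star (l k) * (l a * e)) * i (X a b) * (e * star (l b) * (l m * e)) := by
        have hie : i (X a b) * e = e * i (X a b) * e := by rw [← hcomm, mul_assoc, hee]
        rw [hie]
        simp only [mul_assoc]
      rw [this, hl, hl]
      split_ifs with h2 h3
      · subst h2 h3; rw [← hcomm, mul_assoc, hee]
      · simp
      · simp
      · simp
    rw [hF]
    simp only [Finset.mul_sum, Finset.sum_mul, h1]
    simp
  have hbij : Function.Bijective F := by
    constructor
    · intro X Y hXY
      ext k m
      refine sub_eq_zero.1 (hinj _ ?_)
      rw [map_sub, sub_mul, ← hentry, ← hentry, hXY, sub_self]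
    · intro c
      choose q hq using hcorner
      refine ⟨Matrix.of fun k m => q (star (l k) * c * l m), ?_⟩
      rw [hF]
      simp only [Matrix.of_apply, ← hq]
      have : c = (∑ k, l k * e * star (l k)) * c * ∑ k, l k * e * star (l k) := by
        rw [hsum, one_mul, mul_one]
      conv_rhs => rw [this]
      simp only [Finset.mul_sum, Finset.sum_mul]
      rw [Finset.sum_comm]
      simp only [mul_assoc]
  refine ⟨StarAlgEquiv.ofBijective F hbij, fun d => ?_⟩
  change F _ = _
  rw [hF]
  refine Finset.sum_congr rfl fun k _ => ?_
  rw [Finset.sum_eq_single k]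
  · simp
  · intro m _ hm
    simp [Matrix.diagonal_apply_ne' _ hm]
  · simp

end MatrixAlgebra

section MatrixUnits

variable {P : Type u} [Ring P] [StarRing P] {κ : Type v} [Fintype κ] [DecidableEq κ]
  {f : κ → κ → P}

namespace IsMatrixUnits

variable (hf : IsMatrixUnits f)
include hf

theorem mul_same (a b c : κ) : f a b * f b c = f a c := by rw [hf.mul, if_pos rfl]

theorem spread_mul (o : κ) (x y : P) :
    (∑ c, f c o * x * f o c) * (∑ c, f c o * y * f o c) =
      ∑ c, f c o * (x * f o o * y) * f o c := by
  rw [Finset.sum_mul]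
  refine Finset.sum_congr rfl fun c _ => ?_
  rw [Finset.mul_sum, Finset.sum_eq_single c]
  · rw [mul_assoc, mul_assoc (f c o) y, ← mul_assoc (f o c), hf.mul_same]
    simp only [mul_assoc]
  · intro d _ hd
    rw [mul_assoc, mul_assoc (f d o) y, ← mul_assoc (f o c), hf.mul, if_neg (Ne.symm hd),
      zero_mul, mul_zero]
  · simp

theorem spread_corner (o : κ) (x : P) :
    (∑ c, f c o * x * f o c) * f o o = f o o * x * f o o := by
  rw [Finset.sum_mul, Finset.sum_eq_single o]
  · rw [mul_assoc, hf.mul_same]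
  · intro c _ hc
    rw [mul_assoc, hf.mul, if_neg hc, mul_zero]
  · simp

end IsMatrixUnits

variable [Algebra ℂ P]

/-- An equivalence `w` of `α (f o o)` with `f o o` extends to a unitary `u` such that `Ad u ∘ α`
fixes the matrix units. -/
theorem exists_unitary_of_matrixUnits (hf : IsMatrixUnits f) (o : κ) (α : P ≃⋆ₐ[ℂ] P) {w : P} (h1 : star w * w = α (f o o))
    (h2 : w * star w = f o o) (h3 : f o o * w = w) (h4 : w * α (f o o) = w) :
    ∃ u : unitary P, (∀ a b, (Unitary.conjStarAlgAut ℂ P u * α) (f a b) = f a b) ∧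
      f o o * (u : P) = w ∧ (u : P) * α (f o o) = w ∧ (α = 1 → w = f o o → u = 1) := by
  set u : P := ∑ c, f c o * w * α (f o c) with hu
  have hαmul : ∀ a b c, α (f a b) * α (f b c) = α (f a c) := fun a b c => by
    rw [← map_mul, hf.mul_same]
  have hαmul0 : ∀ a b c d, b ≠ c → α (f a b) * α (f c d) = 0 := fun a b c d h => by
    rw [← map_mul, hf.mul, if_neg h, map_zero]
  have hfu : ∀ a, f o a * u = w * α (f o a) := by
    intro a
    rw [hu, Finset.mul_sum, Finset.sum_eq_single a]
    · rw [← mul_assoc, ← mul_assoc, hf.mul_same, h3]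
    · intro c _ hc
      rw [← mul_assoc, ← mul_assoc, hf.mul, if_neg (Ne.symm hc), zero_mul, zero_mul]
    · simp
  have huα : ∀ a, u * α (f a o) = f a o * w := by
    intro a
    rw [hu, Finset.sum_mul, Finset.sum_eq_single a]
    · rw [mul_assoc, hαmul, mul_assoc, h4]
    · intro c _ hc
      rw [mul_assoc, hαmul0 _ _ _ _ hc, mul_zero]
    · simp
  have hus : star u = ∑ c, α (f c o) * star w * f o c := by
    simp [hu, hf.star, ← map_star, mul_assoc]
  have hαu : ∀ a, α (f o a) * star u = star w * f o a := by
    intro a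
    have := congrArg star (huα a)
    simpa [← map_star, hf.star] using this
  have huu : u * star u = 1 := by
    have : u * star u = ∑ c, f c o * w * α (f o c) * star u := by rw [← Finset.sum_mul]
    rw [this]
    simp_rw [mul_assoc, hαu, ← mul_assoc w, h2, hf.mul_same, hf.sum]
  have huu' : star u * u = 1 := by
    rw [hus, Finset.sum_mul]
    simp_rw [mul_assoc, hfu, ← mul_assoc (star w), h1, hαmul]
    rw [← map_sum, hf.sum, map_one]
  refine ⟨⟨u, Unitary.mem_iff.2 ⟨huu', huu⟩⟩, fun a b => ?_, ?_, ?_, fun hα hw => ?_⟩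
  · change (Unitary.conjStarAlgAut ℂ P _) (α (f a b)) = _
    rw [Unitary.conjStarAlgAut_apply]
    change u * α (f a b) * star u = f a b
    rw [← hαmul a o b, ← mul_assoc, huα, mul_assoc, hαu, mul_assoc, ← mul_assoc w, h2,
      hf.mul_same, hf.mul_same]
  · exact (hfu o).trans h4
  · exact (huα o).trans h3
  · subst hα hw
    refine Subtype.ext ?_
    change u = 1
    rw [hu, ← hf.sum]
    refine Finset.sum_congr rfl fun c _ => ?_
    change f c o * f o o * f o c = _
    rw [hf.mul_same, hf.mul_same]

variable [StarModule ℂ P]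

theorem mem_relCommutant_iff (hf : IsMatrixUnits f) {x : P} :
    x ∈ relCommutant f ↔ ∀ a b, f a b * x = x * f a b := by
  rw [relCommutant, StarSubalgebra.mem_centralizer_iff]
  constructor
  · intro h a b
    exact (h _ ⟨(a, b), rfl⟩).1
  · rintro h _ ⟨⟨a, b⟩, rfl⟩
    exact ⟨h a b, by simp only [hf.star]; exact h b a⟩

namespace IsMatrixUnits

variable (hf : IsMatrixUnits f)
include hf

/-- The element of the relative commutant with the corner `f o o * x * f o o`. -/
theorem spread_mem (o : κ) (x : P) : ∑ c, f c o * x * f o c ∈ relCommutant f := by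
  rw [mem_relCommutant_iff hf]
  intro a b
  rw [Finset.mul_sum, Finset.sum_mul, Finset.sum_eq_single b, Finset.sum_eq_single a]
  · rw [← mul_assoc, ← mul_assoc, hf.mul_same, mul_assoc _ (f o a), hf.mul_same]
  · intro c _ hc
    rw [mul_assoc _ (f o c), hf.mul, if_neg hc, mul_zero]
  · simp
  · intro c _ hc
    rw [← mul_assoc, ← mul_assoc, hf.mul, if_neg (Ne.symm hc), zero_mul, zero_mul]
  · simp

theorem spread_eq (o : κ) {x : P} (hx : x ∈ relCommutant f) :
    ∑ c, f c o * x * f o c = x := by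
  rw [mem_relCommutant_iff hf] at hx
  simp_rw [hx, mul_assoc, hf.mul_same, ← Finset.mul_sum, hf.sum, mul_one]

theorem eq_zero_of_corner (o : κ) {x : P} (hx : x ∈ relCommutant f) (h : x * f o o = 0) :
    x = 0 := by
  have h1 := (mem_relCommutant_iff hf).1 hx
  rw [← hf.spread_eq o hx]
  refine Finset.sum_eq_zero fun c _ => ?_
  rw [← hf.mul_same c o o, mul_assoc (f c o), h1, h, mul_zero, zero_mul]

end IsMatrixUnits

end MatrixUnits

/-! ### The crossed product by a finite group -/

section CrossedProduct

variable {P : Type u} [Ring P] {K : Type v} [Group K] [DecidableEq K]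

theorem crossedUnitary_one : crossedUnitary P (1 : K) = 1 := by
  ext i j
  simp [crossedUnitary, Matrix.one_apply]

theorem star_crossedUnitary [StarRing P] (k : K) :
    star (crossedUnitary P k) = crossedUnitary P k⁻¹ := by
  ext i j
  have : j = k * i ↔ i = k⁻¹ * j := by rw [eq_inv_mul_iff_mul_eq, eq_comm]
  simp only [Matrix.star_apply, crossedUnitary, Matrix.of_apply, this]
  split_ifs <;> simp

variable [Fintype K]

theorem crossedUnitary_mul (k : K) (a : Matrix K K P) (i j : K) :
    (crossedUnitary P k * a) i j = a (k⁻¹ * i) j := by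
  rw [Matrix.mul_apply, Finset.sum_eq_single (k⁻¹ * i)]
  · simp [crossedUnitary]
  · intro l _ hl
    have : i ≠ k * l := fun h => hl (by rw [h, inv_mul_cancel_left])
    simp [crossedUnitary, this]
  · simp

theorem crossedUnitary_mul_crossedUnitary (k l : K) :
    crossedUnitary P k * crossedUnitary P l = crossedUnitary P (k * l) := by
  ext i j
  rw [crossedUnitary_mul, crossedUnitary, crossedUnitary, Matrix.of_apply, Matrix.of_apply]
  simp only [inv_mul_eq_iff_eq_mul, mul_assoc]

variable [StarRing P] [Algebra ℂ P]

theorem crossedDiag_eq (ρ : K →* (P ≃⋆ₐ[ℂ] P)) (x : P) :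
    crossedDiag ρ x = Matrix.diagonal fun k => ρ k⁻¹ x := rfl

theorem crossedDiag_apply_one (ρ : K →* (P ≃⋆ₐ[ℂ] P)) (x : P) : crossedDiag ρ x 1 1 = x := by
  simp [crossedDiag_eq]

variable {ρ : K →* (P ≃⋆ₐ[ℂ] P)}

theorem crossedUnitary_mul_crossedDiag (k : K) (x : P) :
    crossedUnitary P k * crossedDiag ρ x = crossedDiag ρ (ρ k x) * crossedUnitary P k := by
  ext i j
  rw [crossedUnitary_mul, crossedDiag_eq, crossedDiag_eq, Matrix.diagonal_mul,
    Matrix.diagonal_apply, crossedUnitary, Matrix.of_apply]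
  simp only [inv_mul_eq_iff_eq_mul]
  split_ifs with h
  · subst h
    change ρ (k⁻¹ * (k * j))⁻¹ x = (ρ (k * j)⁻¹ * ρ k) x * 1
    rw [mul_one, ← map_mul, inv_mul_cancel_left, mul_inv_rev, inv_mul_cancel_right]
  · simp

variable [StarModule ℂ P]

/-- The matrices in `P ⋊ K` are determined by their first column. -/
theorem crossedProduct_apply {a : Matrix K K P} (ha : a ∈ crossedProduct ρ) (i j g : K) :
    a (i * g) (j * g) = ρ g⁻¹ (a i j) := by
  revert i j g
  refine StarAlgebra.adjoin_induction (p := fun a _ => ∀ i j g, a (i * g) (j * g) = ρ g⁻¹ (a i j))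
    ?_ ?_ ?_ ?_ ?_ ha
  · rintro _ (⟨x, rfl⟩ | ⟨k, rfl⟩) i j g
    · change Matrix.diagonal (fun k => ρ k⁻¹ x) _ _ = ρ g⁻¹ (Matrix.diagonal (fun k => ρ k⁻¹ x) _ _)
      rw [Matrix.diagonal_apply, Matrix.diagonal_apply]
      simp only [mul_left_inj]
      split_ifs
      · rw [mul_inv_rev, map_mul]; rfl
      · simp
    · simp only [crossedUnitary, Matrix.of_apply, ← mul_assoc, mul_left_inj]
      split_ifs <;> simp
  · intro c i j g
    simp only [Matrix.algebraMap_matrix_apply, mul_left_inj, Algebra.algebraMap_eq_smul_one]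
    split_ifs <;> simp
  · intro a b _ _ ha hb i j g
    simp [ha, hb]
  · intro a b _ _ ha hb i j g
    rw [Matrix.mul_apply, Matrix.mul_apply, map_sum]
    refine (Fintype.sum_equiv (Equiv.mulRight g) _ _ fun l => ?_).symm
    simp [ha, hb]
  · intro a _ ha i j g
    simp [Matrix.star_apply, ha, map_star]

/-- The unitary `λ_k` as an element of `P ⋊ K`. -/
def crossedElement (ρ : K →* (P ≃⋆ₐ[ℂ] P)) (k : K) : crossedProduct ρ :=
  ⟨crossedUnitary P k, StarAlgebra.subset_adjoin ℂ _ (Or.inr ⟨k, rfl⟩)⟩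

theorem coe_crossedElement (k : K) :
    (crossedElement ρ k : Matrix K K P) = crossedUnitary P k := rfl

theorem coe_crossedInclusion (x : P) :
    (crossedInclusion ρ x : Matrix K K P) = crossedDiag ρ x := rfl

theorem crossedTrace_apply {τ : P →ₗ[ℂ] ℂ} (a : crossedProduct ρ) :
    crossedTrace τ ρ a = τ ((a : Matrix K K P) 1 1) := rfl

theorem crossedTrace_mul_inclusion (τ : P →ₗ[ℂ] ℂ) (a : crossedProduct ρ) (x : P) :
    crossedTrace τ ρ (a * crossedInclusion ρ x) = τ ((a : Matrix K K P) 1 1 * x) := by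
  rw [crossedTrace_apply, MulMemClass.coe_mul]
  rw [coe_crossedInclusion, crossedDiag_eq, Matrix.mul_diagonal]
  simp

theorem crossedTrace_inclusion_mul (τ : P →ₗ[ℂ] ℂ) (a : crossedProduct ρ) (x : P) :
    crossedTrace τ ρ (crossedInclusion ρ x * a) = τ (x * (a : Matrix K K P) 1 1) := by
  rw [crossedTrace_apply, MulMemClass.coe_mul]
  rw [coe_crossedInclusion, crossedDiag_eq, Matrix.diagonal_mul]
  simp

theorem crossedTrace_star_mul_self (τ : P →ₗ[ℂ] ℂ) (a : crossedProduct ρ) :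
    crossedTrace τ ρ (star a * a) =
      ∑ k, τ (star ((a : Matrix K K P) k 1) * (a : Matrix K K P) k 1) := by
  rw [crossedTrace_apply, MulMemClass.coe_mul, Matrix.mul_apply, map_sum]
  rfl

theorem crossedTrace_faithful {τ : P →ₗ[ℂ] ℂ} (hτ : IsFaithfulTrace τ) (a : crossedProduct ρ)
    (h : crossedTrace τ ρ (star a * a) = 0) : a = 0 := by
  rw [crossedTrace_star_mul_self,
    Finset.sum_eq_zero_iff_of_nonneg fun k _ => hτ.nonneg _] at h
  ext i j
  have h1 := crossedProduct_apply a.2 (i * j⁻¹) 1 j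
  rw [inv_mul_cancel_right, one_mul] at h1
  rw [h1, hτ.faithful _ (h _ (Finset.mem_univ _)), map_zero]
  rfl

/-- The Fourier expansion `a = ∑ λ_k⋆ x_k` with coefficients `x_k = E_P(λ_k a)`. -/
theorem sum_star_crossedElement_mul (a : crossedProduct ρ) :
    ∑ k, star (crossedElement ρ k) *
      crossedInclusion ρ (((crossedElement ρ k * a : crossedProduct ρ) : Matrix K K P) 1 1) =
      a := by
  ext i j
  simp only [AddSubmonoidClass.coe_finsetSum, MulMemClass.coe_mul, StarMemClass.coe_star,
    coe_crossedElement, coe_crossedInclusion, star_crossedUnitary, Matrix.sum_apply,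
    crossedUnitary_mul, inv_inv, mul_one]
  rw [Finset.sum_eq_single (j * i⁻¹)]
  · change Matrix.diagonal (fun k => ρ k⁻¹ _) _ _ = _
    rw [inv_mul_cancel_right, Matrix.diagonal_apply_eq, ← crossedProduct_apply a.2]
    simp
  · intro k _ hk
    change Matrix.diagonal (fun k => ρ k⁻¹ _) _ _ = _
    exact Matrix.diagonal_apply_ne _ fun h => hk (eq_mul_inv_of_mul_eq h)
  · simp

/-- The Jones projection of the basic construction for `P ⊆ P ⋊ K`: it has the corner `P` and,
together with the unitaries `λ_k`, gives matrix units indexed by `K`. -/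
theorem exists_crossed_projection {τ : P →ₗ[ℂ] ℂ} (hP : IsIIOneFactor τ) {C : Type*} [Ring C]
    [StarRing C] [Algebra ℂ C] {j : crossedProduct ρ →⋆ₐ[ℂ] C}
    (hC : IsBasicConstruction (crossedTrace τ ρ) (crossedInclusion ρ).range j) :
    ∃ E : C, star E = E ∧ E * E = E ∧
      (∀ x, j (crossedInclusion ρ x) * E = E * j (crossedInclusion ρ x)) ∧
      (∀ c, ∃ x, E * c * E = j (crossedInclusion ρ x) * E) ∧
      (∀ x, j (crossedInclusion ρ x) * E = 0 → x = 0) ∧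
      (∀ k l, E * j (crossedElement ρ k) * star (j (crossedElement ρ l)) * E =
        if k = l then E else 0) ∧
      ∑ k, star (j (crossedElement ρ k)) * E * j (crossedElement ρ k) = 1 := by
  have hi : ∀ x, x ∈ (crossedInclusion ρ).range ↔ ∃ b, crossedInclusion ρ b = x :=
    fun x => Iff.rfl
  obtain ⟨E, h1, h2, h3, h4, h5, h6, h7⟩ := hC.exists_projection (crossedTrace_faithful hP.trace)
    (crossedInclusion ρ) hi (τ₀ := τ)
    (fun b => by rw [crossedTrace_apply, coe_crossedInclusion, crossedDiag_apply_one]) hP.trace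
    hP.vonNeumann
    (fun a b => by rw [crossedTrace_mul_inclusion, crossedTrace_inclusion_mul, hP.trace.tracial])
    (fun b => by
      obtain ⟨C, hC0, hC⟩ := hP.exists_bound b
      refine ⟨C, hC0, fun a => ?_⟩
      rw [crossedTrace_star_mul_self, crossedTrace_star_mul_self, Complex.re_sum, Complex.re_sum,
        Finset.mul_sum]
      refine Finset.sum_le_sum fun k _ => ?_
      have : ((a * crossedInclusion ρ b : crossedProduct ρ) : Matrix K K P) k 1 =
          (a : Matrix K K P) k 1 * b := by
        rw [MulMemClass.coe_mul, coe_crossedInclusion, crossedDiag_eq, Matrix.mul_diagonal]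
        simp
      rw [this]
      exact hC _)
  have hunit : ∀ k, crossedElement ρ k * star (crossedElement ρ k) = 1 := fun k => by
    refine Subtype.ext ?_
    rw [MulMemClass.coe_mul, StarMemClass.coe_star, coe_crossedElement, star_crossedUnitary,
      crossedUnitary_mul_crossedUnitary, mul_inv_cancel, crossedUnitary_one]
    rfl
  refine ⟨E, h1, h2, h3, h4, fun x hx => ?_, fun k l => ?_, ?_⟩
  · have := h5 (1 - crossedInclusion ρ x) (by rw [map_sub, map_one, sub_mul, hx]; simp)
    have h0 : crossedInclusion ρ x = 0 := by simpa using this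
    rw [← crossedDiag_apply_one ρ x, ← coe_crossedInclusion, h0]
    rfl
  · rw [mul_assoc E, ← map_star, ← map_mul]
    split_ifs with hkl
    · subst hkl
      rw [hunit, map_one, mul_one, h2]
    · refine h6 _ fun b b' => ?_
      rw [← map_star, mul_assoc, crossedTrace_inclusion_mul, MulMemClass.coe_mul,
        MulMemClass.coe_mul, StarMemClass.coe_star, coe_crossedElement, coe_crossedElement,
        star_crossedUnitary, crossedUnitary_mul_crossedUnitary, crossedUnitary_mul,
        coe_crossedInclusion]
      change τ (_ * Matrix.diagonal (fun k => ρ k⁻¹ b') _ _) = 0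
      rw [Matrix.diagonal_apply_ne, mul_zero, map_zero]
      simpa [mul_inv_eq_one, inv_mul_eq_one, eq_comm] using hkl
  · have := h7 (fun k => star (crossedElement ρ k)) fun a => by
      refine ⟨_, fun k b => ?_, sum_star_crossedElement_mul a⟩
      rw [star_star, ← map_star, crossedTrace_inclusion_mul, crossedTrace_inclusion_mul,
        coe_crossedInclusion, crossedDiag_apply_one]
    simpa [map_star] using this

end CrossedProduct

/-! ### The locally trivial inclusion -/

section LocallyTrivialInclusion

variable {P : Type u} [Ring P] [StarRing P] [Algebra ℂ P] {τ : P →ₗ[ℂ] ℂ}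

/-- Let `e P e` consist of elements `y e`, where `y` commutes with `e` and is fixed by an outer
automorphism `α`. Then `e` is orthogonal to `α(e)`: the identity of `e P e = α(e P e)` would
otherwise extend to an intertwiner `∑ aᵢ e α(e) α(bᵢ)` between the identity of `P` and `α`, where
`∑ aᵢ e bᵢ = 1`. -/
theorem IsIIOneFactor.mul_map_eq_zero [StarModule ℂ P] (hP : IsIIOneFactor τ) {α : P ≃⋆ₐ[ℂ] P}
    (hα : ∀ u : unitary P, α ≠ Unitary.conjStarAlgAut ℂ P u) {e : P} (he : star e = e)
    (hee : e * e = e) (he0 : e ≠ 0)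
    (hcorner : ∀ x, ∃ y, α y = y ∧ y * e = e * y ∧ e * x * e = y * e) : e * α e = 0 := by
  obtain ⟨n, a, b, hab⟩ := hP.exists_sum_eq_one he hee he0
  have hαe : α e * α e = α e := by rw [← map_mul, hee]
  have hez : e * (e * α e) = e * α e := by rw [← mul_assoc, hee]
  have hze : e * α e * α e = e * α e := by rw [mul_assoc, hαe]
  have hcomm : ∀ x, e * x * e * (e * α e) = e * α e * α (e * x * e) := by
    intro x
    obtain ⟨y, hy, hye, hx⟩ := hcorner x
    have hy' : y * α e = α e * y := by
      have := congrArg α hye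
      rwa [map_mul, map_mul, hy] at this
    rw [hx, map_mul, hy, mul_assoc y, hez, mul_assoc e, ← mul_assoc (α e) y, ← hy', mul_assoc y,
      hαe, ← mul_assoc y, hye, mul_assoc]
  set z := e * α e with hz
  have hterm : ∀ x i j, a j * e * b j * (x * (a i * z * α (b i))) =
      a j * z * α (b j) * (α x * α (a i * e * b i)) := by
    intro x i j
    have h1 : a j * e * b j * (x * (a i * z * α (b i))) =
        a j * (e * (b j * x * a i) * e * z) * α (b i) := by
      rw [← hez]; simp only [mul_assoc, ← mul_assoc e e, hee]
    have h2 : z * α (e * (b j * x * a i) * e) = z * (α (b j) * α x * α (a i) * α e) := by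
      simp only [map_mul, ← mul_assoc, hze]
    rw [h1, hcomm, h2]
    simp only [map_mul, mul_assoc]
  have hw : ∑ i, a i * z * α (b i) = 0 := by
    refine hP.eq_zero_of_intertwines (fun x => ?_) hα
    calc x * ∑ i, a i * z * α (b i)
        = (∑ j, a j * e * b j) * (∑ i, x * (a i * z * α (b i))) := by
          rw [hab, one_mul, Finset.mul_sum]
      _ = (∑ j, a j * z * α (b j)) * ∑ i, α x * α (a i * e * b i) := by
          simp only [Finset.sum_mul_sum, hterm]
      _ = _ := by rw [← Finset.mul_sum, ← map_sum, hab, map_one, mul_one]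
  calc z = z * α (e * ∑ i, a i * e * b i) := by rw [hab, mul_one, hze]
    _ = ∑ i, z * α (e * a i * e) * α (b i) := by
          simp only [map_sum, Finset.mul_sum, map_mul, mul_assoc]
    _ = ∑ i, e * a i * e * z * α (b i) := by simp only [hcomm]
    _ = e * ∑ i, a i * z * α (b i) := by
          simp only [Finset.mul_sum, mul_assoc, hez]
    _ = 0 := by rw [hw, mul_zero]

variable {H : Type v} [Group H] [Fintype H] [DecidableEq H]

/-- The projections `σ_h(e)` are the diagonal of a system of matrix units. -/
theorem IsIIOneFactor.exists_matrixUnits (hP : IsIIOneFactor τ) (σ : H →* (P ≃⋆ₐ[ℂ] P)) {e : P}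
    (he : star e = e) (hee : e * e = e) (horth : ∀ h h', h ≠ h' → σ h e * σ h' e = 0)
    (hsum : ∑ h, σ h e = 1) :
    ∃ f : H → H → P, IsMatrixUnits f ∧ ∀ h, f h h = σ h e := by
  choose w hw1 hw2 using fun h => hP.exists_equivalence σ h he hee
  have hwe : ∀ h, w h * e = w h := fun h => hP.trace.mul_star_mul_self (hw1 h) hee
  have hew : ∀ h, σ h e * w h = w h := fun h => by rw [← hw2, mul_assoc, hw1, hwe]
  have hwe' : ∀ h, star (w h) * σ h e = star (w h) := fun h => by
    have := congrArg star (hew h)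
    rwa [star_mul, ← map_star, he] at this
  have hww : ∀ b c, star (w b) * w c = if b = c then e else 0 := by
    intro b c
    split_ifs with h
    · rw [h, hw1]
    · rw [← hwe' b, ← hew c, mul_assoc, ← mul_assoc (σ b e), horth b c h, zero_mul, mul_zero]
  refine ⟨fun a b => w a * star (w b), ⟨fun a b c d => ?_, fun a b => ?_, ?_⟩, hw2⟩
  · rw [mul_assoc, ← mul_assoc (star (w b)), hww]
    split_ifs
    · rw [← mul_assoc, hwe]
    · simp
  · simp
  · simp_rw [hw2, hsum]

variable {K : Type w} [Group K] [Fintype K] [DecidableEq K]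

/-- The algebraic core: `κ : P₀ → P` is the inclusion with projection `e`, `C` is generated by `P`,
a projection `E` with `E C E = P E` and elements `g k` that implement `ρ`. The algebra `C` has
matrix units `Λ_{h,k} f₁₁ E Λ_{h,k}⋆`, where `Λ_{h,k} = g_k⋆ v_k⋆ f_{h,1}`, with corner `B' ∩ P`. -/
theorem IsIIOneFactor.exists_locallyTrivial [StarModule ℂ P] (hP : IsIIOneFactor τ)
    (σ : H →* (P ≃⋆ₐ[ℂ] P))
    (ρ : K →* (P ≃⋆ₐ[ℂ] P)) {e : P}
    (he : star e = e) (hee : e * e = e) (horth : ∀ h h', h ≠ h' → σ h e * σ h' e = 0)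
    (hsum : ∑ h, σ h e = 1)
    {P₀ : Type*} [Ring P₀] [StarRing P₀] [Algebra ℂ P₀] (κ : P₀ →⋆ₐ[ℂ] P)
    (hκσ : ∀ h y, σ h (κ y) = κ y) (hκe : ∀ y, κ y * e = e * κ y)
    (hκ : ∀ x, ∃ y, e * x * e = κ y * e) (hκ0 : ∀ y, κ y * e = 0 → y = 0)
    {C : Type*} [Ring C] [StarRing C] [Algebra ℂ C] (ι : P →⋆ₐ[ℂ] C) {E : C} (hE : star E = E)
    (hEE : E * E = E) (hιE : ∀ x, ι x * E = E * ι x) (hC : ∀ c, ∃ x, E * c * E = ι x * E)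
    (hι0 : ∀ x, ι x * E = 0 → x = 0) (g : K → C) (hg : ∀ k x, g k * ι x = ι (ρ k x) * g k)
    (hgE : ∀ k l, E * g k * star (g l) * E = if k = l then E else 0)
    (hgs : ∑ k, star (g k) * E * g k = 1) :
    ∃ (f : H → H → P) (u : H → unitary P) (v : K → unitary P)
      (hσf : ∀ h a b, (Unitary.conjStarAlgAut ℂ P (u h) * σ h) (f a b) = f a b)
      (hρf : ∀ k a b, (Unitary.conjStarAlgAut ℂ P (v k) * ρ k) (f a b) = f a b),
      IsMatrixUnits f ∧ u 1 = 1 ∧ v 1 = 1 ∧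
      InclusionIso (ι.comp κ)
        (locallyTrivial fun p : H × K =>
          (restrictAut (Unitary.conjStarAlgAut ℂ P (u p.1) * σ p.1) (hσf p.1)).trans
            (restrictAut (Unitary.conjStarAlgAut ℂ P (v p.2) * ρ p.2) (hρf p.2))) := by
  obtain ⟨f, hf, hfe⟩ := hP.exists_matrixUnits σ he hee horth hsum
  have hf1 : f 1 1 = e := by rw [hfe, map_one]; rfl
  -- `u h` extends the partial isometry `f 1 h`, which carries `σ h e = f h h` to `e = f 1 1`
  have hu : ∀ h, ∃ u : unitary P,
      (∀ a b, (Unitary.conjStarAlgAut ℂ P u * σ h) (f a b) = f a b) ∧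
      f 1 1 * (u : P) = f 1 h ∧ (u : P) * σ h (f 1 1) = f 1 h ∧ (h = 1 → u = 1) := by
    intro h
    have hσe : σ h (f 1 1) = f h h := by rw [hf1, hfe]
    obtain ⟨u, h1, h2, h3, h4⟩ := exists_unitary_of_matrixUnits hf 1 (σ h) (w := f 1 h)
      (by rw [hf.star, hf.mul_same, hσe]) (by rw [hf.star, hf.mul_same]) (hf.mul_same _ _ _)
      (by rw [hσe, hf.mul_same])
    exact ⟨u, h1, h2, h3, fun hh => h4 (by rw [hh, map_one]) (by rw [hh])⟩
  -- the equivalence of `ρ k e` with `e` is arbitrary for `k ≠ 1`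
  have hv : ∀ k, ∃ v : unitary P,
      (∀ a b, (Unitary.conjStarAlgAut ℂ P v * ρ k) (f a b) = f a b) ∧ (k = 1 → v = 1) := by
    intro k
    by_cases hk : k = 1
    · refine ⟨1, fun a b => ?_, fun _ => rfl⟩
      rw [hk, map_one, map_one]; rfl
    · obtain ⟨w, hw1, hw2⟩ := hP.exists_equivalence ρ k he hee
      have hwe := hP.trace.mul_star_mul_self hw1 hee
      have hwe' : e * star w = star w := by simpa [he] using congrArg star hwe
      obtain ⟨v, h1, -⟩ := exists_unitary_of_matrixUnits hf 1 (ρ k) (w := star w)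
        (by rw [star_star, hw2, hf1]) (by rw [star_star, hw1, hf1]) (by rw [hf1, hwe'])
        (by rw [hf1, ← hw2, ← mul_assoc, hw1, hwe'])
      exact ⟨v, h1, fun h => absurd h hk⟩
  choose u hσf hu1 hu2 hu3 using hu
  choose v hρf hv1 using hv
  have hσ' : ∀ h (x : P), (Unitary.conjStarAlgAut ℂ P (u h) * σ h) x = u h * σ h x * star (u h : P) :=
    fun h x => Unitary.conjStarAlgAut_apply (S := ℂ) (u h) (σ h x)
  have hρ' : ∀ k (x : P), (Unitary.conjStarAlgAut ℂ P (v k) * ρ k) x = v k * ρ k x * star (v k : P) :=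
    fun k x => Unitary.conjStarAlgAut_apply (S := ℂ) (v k) (ρ k x)
  refine ⟨f, u, v, hσf, hρf, hf, hu3 1 rfl, hv1 1 rfl, ?_⟩
  have hQ : ∀ {x : P}, x ∈ relCommutant f ↔ ∀ a b, f a b * x = x * f a b :=
    mem_relCommutant_iff hf
  -- the isomorphism of `P₀` with `B' ∩ P`
  let φ₀ : P₀ →⋆ₙₐ[ℂ] relCommutant f :=
    { toFun := fun y => ⟨∑ c, f c 1 * κ y * f 1 c, hf.spread_mem 1 _⟩
      map_smul' := fun c y => Subtype.ext (by simp [Finset.smul_sum])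
      map_zero' := Subtype.ext (by simp)
      map_add' := fun x y => Subtype.ext (by simp [mul_add, add_mul, Finset.sum_add_distrib])
      map_mul' := fun x y => Subtype.ext (by
        change _ = (∑ c, f c 1 * κ x * f 1 c) * ∑ c, f c 1 * κ y * f 1 c
        rw [hf.spread_mul]
        refine Finset.sum_congr rfl fun c _ => ?_
        rw [hf1, hκe, mul_assoc e, ← map_mul, ← mul_assoc (f c 1), ← hf1, hf.mul_same])
      map_star' := fun y => Subtype.ext (by
        change _ = star (∑ c, f c 1 * κ y * f 1 c)
        simp [star_sum, hf.star, mul_assoc, map_star]) }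
  have hφe : ∀ y, (φ₀ y : P) * e = κ y * e := fun y => by
    change (∑ c, f c 1 * κ y * f 1 c) * e = _
    rw [← hf1, hf.spread_corner, hf1, ← hκe, mul_assoc, hee]
  have hφ : Function.Bijective φ₀ := by
    constructor
    · intro x y hxy
      refine sub_eq_zero.1 (hκ0 _ ?_)
      rw [map_sub, sub_mul, ← hφe, ← hφe, hxy, sub_self]
    · intro q
      obtain ⟨y, hy⟩ := hκ q
      refine ⟨y, Subtype.ext (sub_eq_zero.1 ?_)⟩
      refine hf.eq_zero_of_corner 1 (sub_mem (φ₀ y).2 q.2) ?_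
      have := hQ.1 q.2 1 1
      rw [hf1] at this ⊢
      rw [sub_mul, hφe, ← hy, this, mul_assoc, hee, sub_self]
  let φ : P₀ ≃⋆ₐ[ℂ] relCommutant f := StarAlgEquiv.ofBijective φ₀ hφ
  -- the perturbed automorphism `σ'_h` restores `κ y` from the `h`-th corner
  have hcorner : ∀ h y, (Unitary.conjStarAlgAut ℂ P (u h) * σ h) (φ₀ y) * f h 1 =
      κ y * f h 1 := by
    intro h y
    have hmem := hQ.1 (map_mem_relCommutant _ (hσf h) (φ₀ y).2)
    have hfκ : f h h * κ y = κ y * f h h := by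
      have := congrArg (σ h) (hκe y)
      rw [map_mul, map_mul, hκσ] at this
      rw [hfe, this]
    have hfu : f h h * star (u h : P) = f h 1 := by
      have := congrArg star (hu2 h)
      rwa [star_mul, ← map_star, hf.star, hf.star, hf1, ← hfe] at this
    calc (Unitary.conjStarAlgAut ℂ P (u h) * σ h) (φ₀ y) * f h 1
        = f h 1 * (f 1 1 * (Unitary.conjStarAlgAut ℂ P (u h) * σ h) (φ₀ y)) := by
          rw [← hmem, ← mul_assoc, hf.mul_same]
      _ = f h 1 * (u h * σ h (φ₀ y * e) * star (u h : P)) := by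
          conv_lhs => rw [← hσf h 1 1, ← map_mul, hQ.1 (φ₀ y).2, hf1, hσ']
      _ = f h 1 * (f 1 1 * u h) * κ y * (f h h * star (u h : P)) := by
          rw [hφe, map_mul, hκσ, ← hfe]
          simp only [← mul_assoc, hf.mul_same]
      _ = κ y * f h 1 := by
          rw [hu1, hf.mul_same, hfu, hfκ, mul_assoc, hf.mul_same]
  have hgs' : ∀ k x, ι x * star (g k) = star (g k) * ι (ρ k x) := fun k x => by
    have := congrArg star (hg k (star x))
    simpa [← map_star] using this
  have hιι : ∀ x y c, ι x * (ι y * c) = ι (x * y) * c := fun x y c => by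
    rw [map_mul, mul_assoc]
  let Λ : H × K → C := fun p => star (g p.2) * ι (star (v p.2 : P) * f p.1 1)
  let i : relCommutant f →⋆ₐ[ℂ] C := ι.comp (relCommutant f).subtype
  have hi : ∀ q, i q = ι q := fun _ => rfl
  have hvv : ∀ k, (v k : P) * star (v k : P) = 1 := fun k => Unitary.mul_star_self_of_mem (v k).2
  have hvv' : ∀ k, star (v k : P) * (v k : P) = 1 := fun k => Unitary.star_mul_self_of_mem (v k).2
  have hΛs : ∀ p, star (Λ p) = ι (f 1 p.1 * v p.2) * g p.2 := fun p => by
    simp [Λ, ← map_star, hf.star]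
  have hΛΛ : ∀ p q, ι e * E * star (Λ p) * (Λ q * (ι e * E)) =
      if p = q then ι e * E else 0 := by
    rintro ⟨h, k⟩ ⟨h', l⟩
    have a1 : ι e * E * ι (f 1 h * v k) = ι (e * (f 1 h * v k)) * E := by
      rw [mul_assoc, ← hιE, hιι]
    have a2 : ι (star (v l : P) * f h' 1) * (ι e * E) = E * ι (star (v l : P) * f h' 1 * e) := by
      rw [hιι, hιE]
    have a3 : ι e * E * star (Λ (h, k)) * (Λ (h', l) * (ι e * E)) =
        ι (e * (f 1 h * v k)) * (E * g k * star (g l) * E) * ι (star (v l : P) * f h' 1 * e) := by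
      rw [hΛs, ← mul_assoc (ι e * E), a1, mul_assoc (star (g l)), a2]
      simp only [mul_assoc]
    rw [a3, hgE]
    by_cases hkl : k = l
    · subst hkl
      rw [if_pos rfl, mul_assoc, ← hιE, hιι]
      have a4 : e * (f 1 h * v k) * (star (v k : P) * f h' 1 * e) =
          e * (f 1 h * (v k * star (v k : P)) * f h' 1) * e := by
        simp only [mul_assoc]
      rw [a4, hvv, mul_one, hf.mul]
      by_cases hh : h = h'
      · subst hh
        rw [if_pos rfl, if_pos rfl, hf1, hee, hee]
      · rw [if_neg hh, if_neg (fun hp => hh (congrArg Prod.fst hp))]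
        simp
    · rw [if_neg hkl, if_neg (fun hp => hkl (congrArg Prod.snd hp))]
      simp
  have hΛsum : ∑ p, Λ p * (ι e * E) * star (Λ p) = 1 := by
    have h1 : ∀ h k, Λ (h, k) * (ι e * E) * star (Λ (h, k)) =
        star (g k) * (ι (star (v k : P) * f h h * v k) * E) * g k := by
      intro h k
      have : star (v k : P) * f h h * v k = star (v k : P) * f h 1 * e * (f 1 h * v k) := by
        rw [← hf1, mul_assoc (star (v k : P)) (f h 1), hf.mul_same, mul_assoc, mul_assoc,
          ← mul_assoc (f h 1), hf.mul_same]
      rw [hΛs, this, map_mul _ (_ * e), mul_assoc (ι _), hιE (f 1 h * v k), map_mul _ _ e]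
      simp only [Λ, mul_assoc]
    rw [Fintype.sum_prod_type_right]
    simp_rw [h1, ← Finset.sum_mul, ← Finset.mul_sum, ← Finset.sum_mul, ← map_sum,
      ← Finset.sum_mul, ← Finset.mul_sum, hf.sum, mul_one, hvv', map_one, one_mul]
    exact hgs
  obtain ⟨Ψ, hΨ⟩ := exists_matrixEquiv i (e := ι e * E) Λ
    (by rw [star_mul, hE, ← map_star, he, hιE])
    (by rw [mul_assoc, ← mul_assoc E, ← hιE, mul_assoc, hEE, ← mul_assoc, ← map_mul, hee])
    (fun q => by
      have := hQ.1 q.2 1 1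
      rw [hf1] at this
      rw [hi, hιι, ← this, mul_assoc (ι e), ← hιE, hιι])
    hΛΛ hΛsum
    (fun c => by
      obtain ⟨x, hx⟩ := hC c
      refine ⟨⟨_, hf.spread_mem 1 x⟩, ?_⟩
      have h1 : ι e * E * c * (ι e * E) = ι e * (E * c * E) * ι e := by
        rw [← mul_assoc (ι e), ← mul_assoc (ι e), mul_assoc _ E (ι e), ← hιE]
      rw [hi, hιι, h1, hx, hιι, mul_assoc, ← hιE, hιι]
      congr 2
      change _ = (∑ c, f c 1 * x * f 1 c) * e
      rw [← hf1, hf.spread_corner])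
    (fun q hq => by
      rw [hi, hιι] at hq
      have := hι0 _ hq
      rw [← hf1] at this
      exact Subtype.ext (hf.eq_zero_of_corner 1 q.2 this))
  refine ⟨φ, Ψ.symm, fun y => ?_⟩
  rw [StarAlgEquiv.symm_apply_eq]
  refine Eq.trans ?_ (hΨ _).symm
  have hΛκ : ∀ h k (q : relCommutant f),
      (q : P) = (Unitary.conjStarAlgAut ℂ P (v k) * ρ k)
        ((Unitary.conjStarAlgAut ℂ P (u h) * σ h) (φ₀ y)) →
      Λ (h, k) * (i q * (ι e * E)) = ι (κ y) * (Λ (h, k) * (ι e * E)) := by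
    intro h k q hq
    have h1 : star (v k : P) * f h 1 * q = ρ k (κ y) * (star (v k : P) * f h 1) := by
      rw [mul_assoc, hQ.1 q.2, hq, ← hρf k h 1, ← map_mul, hρf, hcorner, map_mul, hρf, hρ',
        ← mul_assoc, ← mul_assoc, ← mul_assoc, hvv', one_mul, mul_assoc]
    change star (g k) * ι _ * _ = ι (κ y) * (star (g k) * ι _ * _)
    rw [hi, mul_assoc, hιι, h1, ← mul_assoc (ι (κ y)), ← mul_assoc (ι (κ y)), hgs', map_mul]
    simp only [mul_assoc]
  have hsum' : ι (κ y) = ∑ p, ι (κ y) * (Λ p * (ι e * E)) * star (Λ p) := by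
    simp_rw [mul_assoc (ι (κ y)), ← Finset.mul_sum]
    rw [hΛsum, mul_one]
  refine hsum'.trans (Finset.sum_congr rfl fun p _ => ?_)
  rw [hΛκ p.1 p.2 _ rfl]

end LocallyTrivialInclusion

end Subfactor

end

theorem proposition2p7
    {P : Type u} [Ring P] [StarRing P] [Algebra ℂ P] [StarModule ℂ P]
    -- the II₁ factor `P` and its trace
    (τ : P →ₗ[ℂ] ℂ) (hP : Subfactor.IsIIOneFactor τ)
    {H : Type v} [Group H] [Fintype H] [DecidableEq H]
    {K : Type w} [Group K] [Fintype K] [DecidableEq K]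
    (σ : H →* (P ≃⋆ₐ[ℂ] P)) (hσ : Subfactor.IsProperlyOuter σ)
    (ρ : K →* (P ≃⋆ₐ[ℂ] P)) (hρ : Subfactor.IsProperlyOuter ρ)
    -- a II₁ factor `P₋₁ ⊆ N = P^H` for which `N ⊆ P` is the basic construction
    (Pm : StarSubalgebra ℂ (Subfactor.fixedAlgebra σ))
    (hPm : Subfactor.IsIIOneFactor
      (Subfactor.restrictTrace (Subfactor.restrictTrace τ (Subfactor.fixedAlgebra σ)) Pm))
    (hNP : Subfactor.IsBasicConstruction
      (Subfactor.restrictTrace τ (Subfactor.fixedAlgebra σ)) Pm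
      (Subfactor.fixedAlgebra σ).subtype)
    -- the basic construction `M → P₁` for `P ⊆ M = P ⋊ K`
    {P₁ : Type*} [Ring P₁] [StarRing P₁] [Algebra ℂ P₁]
    (j : Subfactor.crossedProduct ρ →⋆ₐ[ℂ] P₁)
    (hMP₁ : Subfactor.IsBasicConstruction (Subfactor.crossedTrace τ ρ)
      (Subfactor.crossedInclusion ρ).range j) :
    -- matrix units of a factor `B ≅ B(ℓ²(H))` in `P`, and inner perturbations
    -- `Ad (u h) ∘ σ h`, `Ad (v k) ∘ ρ k` that fix them
    ∃ (f : H → H → P) (u : H → unitary P) (v : K → unitary P)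
      (hσf : ∀ h a b, (Unitary.conjStarAlgAut ℂ P (u h) * σ h) (f a b) = f a b)
      (hρf : ∀ k a b, (Unitary.conjStarAlgAut ℂ P (v k) * ρ k) (f a b) = f a b),
      Subfactor.IsMatrixUnits f ∧ u 1 = 1 ∧ v 1 = 1 ∧
      Subfactor.InclusionIso
        (j.comp ((Subfactor.crossedInclusion ρ).comp
          ((Subfactor.fixedAlgebra σ).subtype.comp Pm.subtype)))
        (Subfactor.locallyTrivial fun p : H × K =>
          (Subfactor.restrictAut (Unitary.conjStarAlgAut ℂ P (u p.1) * σ p.1) (hσf p.1)).trans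
            (Subfactor.restrictAut (Unitary.conjStarAlgAut ℂ P (v p.2) * ρ p.2) (hρf p.2))) := by
  obtain ⟨E, hE, hEE, hιE, hC, hι0, hgE, hgs⟩ := Subfactor.exists_crossed_projection hP hMP₁
  have hN : ∀ (h : H) (x : Subfactor.fixedAlgebra σ), σ h x = x := fun h x => x.2 h
  obtain ⟨e, he, hee, hκe, hκ, he1, -, -⟩ :=
    Subfactor.IsBasicConstruction.exists_projection.{u, v, u, u} hNP
    (fun a ha => Subtype.ext (hP.trace.faithful _ ha)) Pm.subtype
    (fun x => ⟨fun hx => ⟨⟨x, hx⟩, rfl⟩, fun ⟨y, hy⟩ => hy ▸ y.2⟩) (fun _ => rfl) hPm.trace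
    hPm.vonNeumann (fun a b => hP.trace.tracial _ _) (fun b => by
      obtain ⟨C, hC0, hC⟩ := hP.exists_bound ((b : Subfactor.fixedAlgebra σ) : P)
      exact ⟨C, hC0, fun a => hC _⟩)
  have h10 : (1 : P) ≠ 0 := fun h => by
    have := hP.trace.map_one
    rw [h, map_zero] at this
    exact zero_ne_one this
  have he0 : e ≠ 0 := by
    intro h
    have := congrArg Subtype.val (he1 0 (by rw [h]; simp))
    exact h10 this.symm
  have horth1 : ∀ h : H, h ≠ 1 → e * σ h e = 0 := fun h hh =>
    hP.mul_map_eq_zero (hσ h hh) he hee he0 fun x => by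
      obtain ⟨y, hy⟩ := hκ x
      exact ⟨_, hN h y, hκe y, hy⟩
  have horth : ∀ h h' : H, h ≠ h' → σ h e * σ h' e = 0 := by
    intro h h' hh
    have h1 := congrArg (σ h) (horth1 (h⁻¹ * h') fun h0 => hh (inv_mul_eq_one.1 h0))
    rw [map_mul, map_zero] at h1
    rw [← h1]
    congr 1
    change _ = (σ h * σ (h⁻¹ * h')) e
    rw [← map_mul, mul_inv_cancel_left]
  have hsum : ∑ h, σ h e = 1 := by
    have hmem : ∑ h, σ h e ∈ Subfactor.fixedAlgebra σ := by
      intro g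
      rw [map_sum]
      refine Fintype.sum_equiv (Equiv.mulLeft g) _ _ fun h => ?_
      simp [map_mul]
    -- an element of `N` that fixes the Jones projection is `1`
    refine congrArg Subtype.val (he1 ⟨_, hmem⟩ ?_)
    change (∑ h, σ h e) * e = e
    rw [Finset.sum_mul, Finset.sum_eq_single 1]
    · rw [map_one]; exact hee
    · intro h _ hh
      have := horth h 1 hh
      rwa [map_one] at this
    · simp
  exact hP.exists_locallyTrivial σ ρ he hee horth hsum
    ((Subfactor.fixedAlgebra σ).subtype.comp Pm.subtype) (fun h y => hN h y) hκe hκ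
    (fun y hy => by
      have h1 := he1 (1 - y) (by
        rw [map_sub, map_one, sub_mul, one_mul]
        exact (congrArg (e - ·) hy).trans (sub_zero e))
      exact Subtype.ext (by simpa using h1))
    (j.comp (Subfactor.crossedInclusion ρ)) hE hEE hιE hC hι0
    (fun k => j (Subfactor.crossedElement ρ k))
    (fun k x => by
      change j _ * j _ = j _ * j _
      rw [← map_mul, ← map_mul]
      exact congrArg j (Subtype.ext (Subfactor.crossedUnitary_mul_crossedDiag k x)))
    hgE hgs
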